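/- Over $\mathsf{RCA}_0$, the principle $\mathsf{RP}$ implies weak König's lemma $\mathsf{WKL}$; that is, every model $\mathcal M$ of $\mathsf{RCA}_0$ (with possibly nonstandard first-order part) in which $\mathsf{RP}$ holds satisfies $\mathsf{WKL}$. Here $\mathsf{RCA}_0$ is the theory in the language of second-order arithmetic consisting of the basic axioms for $0,1,+,\cdot,<$, the induction scheme for $\Sigma^0_1$ formulas and the comprehension scheme for $\Delta^0_1$ formulas (with number and set parameters). The following definitions are made in $\mathsf{RCA}_0$; finite binary strings are coded by numbers and sets of numbers are identified with points of $2^\omega$. We write $\preceq$ for "is an initial segment of", $\lambda$ for the empty string, and $X{\upharpoonright} l$ for the string of the first $l$ bits of $X$. A *tree* is a set $C\subseteq 2^{<\omega}$ closed under initial segments, and $[C]$ is the collection of its paths, i.e. of the $X\in 2^\omega$ with $X{\upharpoonright} l\in C$ for all $l$. $\mathsf{WKL}$ is the statement that every infinite tree $T\subseteq 2^{<\omega}$ has a path. A total function $f:2^{<\omega}\to 2^{<\omega}$ *encodes a continuous transformation of $2^\omega$* if $\sigma\preceq\tau$ implies $f(\sigma)\preceq f(\tau)$, if $(\forall l)(\exists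 m)(\forall\sigma\in\{0,1\}^m)\,|f(\sigma)|\ge l$, and if (a normalization) $|f(\sigma)|<|\sigma|$ for all $\sigma\ne\lambda$. Its iterates are defined by $f^0(\sigma)=\sigma$, $f^{k+1}(\sigma)=f(f^{k}(\sigma))$, and $F^k(X)=\lim_{l} f^k(X{\upharpoonright} l)$. A pair $(C,f)$ of sets *encodes a topological dynamical system* on $2^\omega$ if $C$ is a tree, $f$ encodes a continuous transformation of $2^\omega$, $[C]\neq\emptyset$, and $f(\sigma)\in C$ for all $\sigma\in C$. A *recurrent point* of $(C,f)$ is an $X\in[C]$ such that $(\forall n,c)(\exists k)\; F^{n+k}(X)\succeq X{\upharpoonright} c$. $\mathsf{RP}$ is the statement that every $(C,f)$ encoding a topological dynamical system on $2^\omega$ has a recurrent point. -/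

import Mathlib

universe u

namespace SecondOrderArith

/-! ### Structures for the language of second-order arithmetic -/

/-- A structure for the language of second-order arithmetic: a first-order part `Num` (possibly
nonstandard) with `0, 1, +, *, <`, and a collection `sets` of subsets of `Num` over which the set
variables range. -/
structure L2Structure where
  Num : Type u
  zero : Num
  one : Num
  add : Num → Num → Num
  mul : Num → Num → Num
  lt : Num → Num → Prop
  sets : Set (Set Num)

namespace L2Structure

instance (M : L2Structure.{u}) : Zero M.Num := ⟨M.zero⟩
instance (M : L2Structure.{u}) : One M.Num := ⟨M.one⟩
instance (M : L2Structure.{u}) : Add M.Num := ⟨M.add⟩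
instance (M : L2Structure.{u}) : Mul M.Num := ⟨M.mul⟩
instance (M : L2Structure.{u}) : LT M.Num := ⟨M.lt⟩

end L2Structure

/-! ### Bounded-quantifier formulas -/

/-- Number terms in the number variables `x₀, …, xₙ₋₁`. -/
inductive NumTerm (n : ℕ) : Type
  | var (i : Fin n) : NumTerm n
  | zero : NumTerm n
  | one : NumTerm n
  | add (s t : NumTerm n) : NumTerm n
  | mul (s t : NumTerm n) : NumTerm n

/-- Formulas all of whose quantifiers are bounded number quantifiers, in `k` set variables and `n`
number variables. In `ball t φ` (for all `x < t`, `φ`) and `bex t φ` (for some `x < t`, `φ`) the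
quantified variable is the variable `0` of `φ`, and the variable `i` of `t` is the variable
`i + 1` of `φ`. -/
inductive BddFormula (k : ℕ) : ℕ → Type
  | eq {n : ℕ} (s t : NumTerm n) : BddFormula k n
  | lt {n : ℕ} (s t : NumTerm n) : BddFormula k n
  | mem {n : ℕ} (t : NumTerm n) (X : Fin k) : BddFormula k n
  | neg {n : ℕ} (φ : BddFormula k n) : BddFormula k n
  | and {n : ℕ} (φ ψ : BddFormula k n) : BddFormula k n
  | or {n : ℕ} (φ ψ : BddFormula k n) : BddFormula k n
  | ball {n : ℕ} (t : NumTerm n) (φ : BddFormula k (n + 1)) : BddFormula k n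
  | bex {n : ℕ} (t : NumTerm n) (φ : BddFormula k (n + 1)) : BddFormula k n

namespace L2Structure

/-- The value of a number term. -/
def termValue (M : L2Structure.{u}) {n : ℕ} (v : Fin n → M.Num) : NumTerm n → M.Num
  | .var i => v i
  | .zero => 0
  | .one => 1
  | .add s t => M.termValue v s + M.termValue v t
  | .mul s t => M.termValue v s * M.termValue v t

/-- Truth of a bounded-quantifier formula, where the set variables are assigned the sets `A` and
the number variables the numbers `v`. -/
def Holds (M : L2Structure.{u}) {k : ℕ} (A : Fin k → Set M.Num) :
    {n : ℕ} → BddFormula k n → (Fin n → M.Num) → Prop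
  | _, .eq s t, v => M.termValue v s = M.termValue v t
  | _, .lt s t, v => M.termValue v s < M.termValue v t
  | _, .mem t X, v => M.termValue v t ∈ A X
  | _, .neg φ, v => ¬ M.Holds A φ v
  | _, .and φ ψ, v => M.Holds A φ v ∧ M.Holds A ψ v
  | _, .or φ ψ, v => M.Holds A φ v ∨ M.Holds A ψ v
  | _, .ball t φ, v => ∀ x : M.Num, x < M.termValue v t → M.Holds A φ (Fin.cons x v)
  | _, .bex t φ, v => ∃ x : M.Num, x < M.termValue v t ∧ M.Holds A φ (Fin.cons x v)

/-! ### The axioms of `RCA₀` -/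

/-- The basic axioms of second-order arithmetic. -/
structure BasicAxioms (M : L2Structure.{u}) : Prop where
  succ_ne_zero : ∀ n : M.Num, n + 1 ≠ 0
  succ_inj : ∀ m n : M.Num, m + 1 = n + 1 → m = n
  add_zero : ∀ m : M.Num, m + 0 = m
  add_succ : ∀ m n : M.Num, m + (n + 1) = (m + n) + 1
  mul_zero : ∀ m : M.Num, m * 0 = 0
  mul_succ : ∀ m n : M.Num, m * (n + 1) = m * n + m
  not_lt_zero : ∀ m : M.Num, ¬ m < 0
  lt_succ_iff : ∀ m n : M.Num, m < n + 1 ↔ m < n ∨ m = n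

/-- The induction scheme for `Σ⁰₁` formulas `φ(x) = ∃ y, θ(y, x)`, with number parameters `v` and
set parameters `A`. -/
def SigmaOneInduction (M : L2Structure.{u}) : Prop :=
  ∀ (k n : ℕ) (θ : BddFormula k (n + 2)) (A : Fin k → Set M.Num) (v : Fin n → M.Num),
    (∀ i, A i ∈ M.sets) →
    (∃ y : M.Num, M.Holds A θ (Fin.cons y (Fin.cons 0 v))) →
    (∀ x : M.Num, (∃ y : M.Num, M.Holds A θ (Fin.cons y (Fin.cons x v))) →
      ∃ y : M.Num, M.Holds A θ (Fin.cons y (Fin.cons (x + 1) v))) →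
    ∀ x : M.Num, ∃ y : M.Num, M.Holds A θ (Fin.cons y (Fin.cons x v))

/-- The comprehension scheme for `Δ⁰₁` formulas, that is `Σ⁰₁` formulas `∃ y, θ(y, x)` that are
equivalent in the structure to a `Π⁰₁` formula `∀ y, η(y, x)`, with number parameters `v` and set
parameters `A`. -/
def DeltaOneComprehension (M : L2Structure.{u}) : Prop :=
  ∀ (k n : ℕ) (θ η : BddFormula k (n + 2)) (A : Fin k → Set M.Num) (v : Fin n → M.Num),
    (∀ i, A i ∈ M.sets) →
    (∀ x : M.Num, (∃ y : M.Num, M.Holds A θ (Fin.cons y (Fin.cons x v))) ↔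
      ∀ y : M.Num, M.Holds A η (Fin.cons y (Fin.cons x v))) →
    ∃ X ∈ M.sets, ∀ x : M.Num, x ∈ X ↔ ∃ y : M.Num, M.Holds A θ (Fin.cons y (Fin.cons x v))

/-- `M` is a model of `RCA₀`. -/
structure ModelsRCA₀ (M : L2Structure.{u}) : Prop where
  basic : M.BasicAxioms
  induction : M.SigmaOneInduction
  comprehension : M.DeltaOneComprehension

/-! ### Functions and finite binary strings inside a structure

Everything from here on is the interpretation in `M` of a formula of second-order arithmetic: all
quantifiers range over the numbers of `M` and the sets in `M.sets`. -/

/-- The pairing `(x, y) ↦ (x + y)² + x`. -/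
def pair (M : L2Structure.{u}) (x y : M.Num) : M.Num := (x + y) * (x + y) + x

/-- The set `g` is (the graph of) a total function from numbers to numbers. -/
def IsFunction (M : L2Structure.{u}) (g : Set M.Num) : Prop :=
  (∀ z ∈ g, ∃ x y : M.Num, z = M.pair x y) ∧
    ∀ x : M.Num, ∃! y : M.Num, M.pair x y ∈ g

/-- `2 ^ x = y`, exponentiation being defined by primitive recursion. -/
def PowTwo (M : L2Structure.{u}) (x y : M.Num) : Prop :=
  ∃ g ∈ M.sets, M.IsFunction g ∧ M.pair 0 1 ∈ g ∧
    (∀ i a : M.Num, M.pair i a ∈ g → M.pair (i + 1) ((1 + 1) * a) ∈ g) ∧ M.pair x y ∈ g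

/-- Finite binary strings are coded by the nonzero numbers: the string `b₀ b₁ … bₗ₋₁` is coded by
the number with binary expansion `1 b₀ b₁ … bₗ₋₁`. -/
def IsString (M : L2Structure.{u}) (σ : M.Num) : Prop := σ ≠ 0

/-- The code of the empty string. -/
def emptyString (M : L2Structure.{u}) : M.Num := 1

/-- The string `σ` followed by the bit `0`. -/
def appendZero (M : L2Structure.{u}) (σ : M.Num) : M.Num := (1 + 1) * σ

/-- The string `σ` followed by the bit `1`. -/
def appendOne (M : L2Structure.{u}) (σ : M.Num) : M.Num := (1 + 1) * σ + 1

/-- The string `σ` has length `l`: the number `σ` satisfies `2 ^ l ≤ σ < 2 ^ (l + 1)`. -/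
def HasLength (M : L2Structure.{u}) (σ l : M.Num) : Prop :=
  ∃ p : M.Num, M.PowTwo l p ∧ (p < σ ∨ p = σ) ∧ σ < (1 + 1) * p

/-- The string `σ` is an initial segment (not necessarily proper) of the string `τ`:
`τ = σ * 2 ^ j + r` for some `j` and some `r < 2 ^ j`. -/
def IsPrefix (M : L2Structure.{u}) (σ τ : M.Num) : Prop :=
  M.IsString σ ∧ ∃ j p r : M.Num, M.PowTwo j p ∧ r < p ∧ τ = σ * p + r

/-- A set of numbers `X` is identified with the infinite binary sequence that is its characteristic
function. `IsRestriction X l σ` says that `σ` is the string `X ↾ l` of its first `l` bits. -/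
def IsRestriction (M : L2Structure.{u}) (X : Set M.Num) (l σ : M.Num) : Prop :=
  M.HasLength σ l ∧ ∀ i : M.Num, i < l → ∃ ρ : M.Num, M.HasLength ρ i ∧
    (i ∈ X → M.IsPrefix (M.appendOne ρ) σ) ∧ (i ∉ X → M.IsPrefix (M.appendZero ρ) σ)

/-! ### Trees, paths, and weak König's lemma -/

/-- `T` is a tree: a set of binary strings closed under initial segments. -/
def IsTree (M : L2Structure.{u}) (T : Set M.Num) : Prop :=
  (∀ σ ∈ T, M.IsString σ) ∧ ∀ σ τ : M.Num, τ ∈ T → M.IsPrefix σ τ → σ ∈ T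

/-- `X` is a path through `T`, that is, `X ∈ [T]`. -/
def IsPath (M : L2Structure.{u}) (T X : Set M.Num) : Prop :=
  ∀ l : M.Num, ∃ σ ∈ T, M.IsRestriction X l σ

/-- The set `T` is infinite in the sense of `M`, that is, unbounded. -/
def IsInfinite (M : L2Structure.{u}) (T : Set M.Num) : Prop :=
  ∀ n : M.Num, ∃ σ ∈ T, n < σ

/-- Weak König's lemma: every infinite binary tree has a path. -/
def WKL (M : L2Structure.{u}) : Prop :=
  ∀ T ∈ M.sets, M.IsTree T → M.IsInfinite T → ∃ X ∈ M.sets, M.IsPath T X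

/-! ### Topological dynamical systems on Cantor space, and recurrent points -/

/-- The set `f` is the graph of a function `2^{<ω} → 2^{<ω}` encoding a continuous transformation of
Cantor space; values on nonempty strings are normalized to be shorter than the argument. -/
structure EncodesTransformation (M : L2Structure.{u}) (f : Set M.Num) : Prop where
  graph : ∀ z ∈ f, ∃ σ τ : M.Num, M.IsString σ ∧ M.IsString τ ∧ z = M.pair σ τ
  total : ∀ σ : M.Num, M.IsString σ → ∃! τ : M.Num, M.pair σ τ ∈ f
  monotone : ∀ σ σ' τ τ' : M.Num, M.pair σ τ ∈ f → M.pair σ' τ' ∈ f →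
    M.IsPrefix σ σ' → M.IsPrefix τ τ'
  unbounded : ∀ l : M.Num, ∃ m : M.Num, ∀ σ : M.Num, M.HasLength σ m →
    ∃ τ j : M.Num, M.pair σ τ ∈ f ∧ M.HasLength τ j ∧ (l < j ∨ l = j)
  shorter : ∀ σ τ : M.Num, M.pair σ τ ∈ f → σ ≠ M.emptyString →
    ∃ i j : M.Num, M.HasLength τ i ∧ M.HasLength σ j ∧ i < j

/-- `(C, f)` encodes a topological dynamical system on Cantor space. -/
structure EncodesSystem (M : L2Structure.{u}) (C f : Set M.Num) : Prop where
  tree : M.IsTree C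
  transformation : M.EncodesTransformation f
  nonempty : ∃ X ∈ M.sets, M.IsPath C X
  invariant : ∀ σ τ : M.Num, σ ∈ C → M.pair σ τ ∈ f → τ ∈ C

/-- `f^k(σ) = τ`, where the iterates of `f` are defined by primitive recursion. -/
def IterString (M : L2Structure.{u}) (f : Set M.Num) (k σ τ : M.Num) : Prop :=
  ∃ g ∈ M.sets, M.IsFunction g ∧ M.pair 0 σ ∈ g ∧
    (∀ i a b : M.Num, M.pair i a ∈ g → M.pair (i + 1) b ∈ g → M.pair a b ∈ f) ∧ M.pair k τ ∈ g

/-- `F^k(X) = Y`, that is, `Y` is the limit over `l` of the strings `f^k(X ↾ l)`: every `Y ↾ c` is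
an initial segment of some `f^k(X ↾ l)`. -/
def IterPoint (M : L2Structure.{u}) (f : Set M.Num) (k : M.Num) (X Y : Set M.Num) : Prop :=
  ∀ c : M.Num, ∃ l σ τ ρ : M.Num, M.IsRestriction X l σ ∧ M.IterString f k σ τ ∧
    M.IsRestriction Y c ρ ∧ M.IsPrefix ρ τ

/-- `X` is a recurrent point of `(C, f)`: it lies in `[C]`, and for all `n` and `c` there is `k` such
that `F^{n+k}(X)` extends `X ↾ c`. -/
def IsRecurrentPoint (M : L2Structure.{u}) (C f X : Set M.Num) : Prop :=
  M.IsPath C X ∧ ∀ n c : M.Num, ∃ k : M.Num, ∃ Y ∈ M.sets, M.IterPoint f (n + k) X Y ∧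
    ∃ ρ : M.Num, M.IsRestriction X c ρ ∧ M.IsRestriction Y c ρ

/-- The principle `RP`: every topological dynamical system on Cantor space has a recurrent point. -/
def RP (M : L2Structure.{u}) : Prop :=
  ∀ C ∈ M.sets, ∀ f ∈ M.sets, M.EncodesSystem C f → ∃ X ∈ M.sets, M.IsRecurrentPoint C f X

end L2Structure

end SecondOrderArith

/-! Let `T` be an infinite tree. Read a point of Cantor space as `(Z, A₀, A₁, …)` and let the
transformation be `(Z, A₀, A₁, …) ↦ (0Z, A₁, A₂, …)`. Let the closed set consist of the points such
that, whenever `Z` begins with `n` zeros, `Aᵢ ↾ (n + i)` lies in `T` for every `i`. It is invariant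
(`IsShift.inSystem`): prefixing a zero raises `n` by one while dropping `A₀` lowers the index by
one, so `n + i` is preserved. It has a computable member (`exists_isPath_inSystem`): let `Z` begin
with `1`, so that only `n = 0` counts, and let `Aᵢ` extend some string of length `i` in `T`, found
by search. No compactness is used.

The `m`-th iterate of any point has `m` leading zeros in its first component
(`not_bit_of_iterString`). A recurrent point is approximated by arbitrarily late iterates of itself,
so its `Z` is identically zero. The condition at `i = 0` then holds for all `n`, and `A₀` is a path
through `T` (`exists_isPath_of_isRecurrentPoint`).

The model may be nonstandard, so the rest is a development of arithmetic inside it. The numbers are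
made an ordered semiring. `Pr` and `Fn` name the predicates and functions given by sets of the
model, and closure lemmas for them (substitution, bounded quantifiers, search) replace explicit
formulas. Powers of two come from computation histories coded in the manner of Gödel's β-function,
and strings are handled through their lengths and bits. -/

namespace SecondOrderArith

namespace L2Structure

section Arithmetic

variable {M : L2Structure.{u}}

/-! ### Arithmetic in a model of `RCA₀` -/

namespace ModelsRCA₀

/-- Induction for a bounded formula with number parameters `v`. -/
theorem bddInduction (hM : M.ModelsRCA₀) {n : ℕ} (θ : BddFormula 0 (n + 2)) (v : Fin n → M.Num)
    (h0 : M.Holds Fin.elim0 θ (Fin.cons 0 (Fin.cons 0 v)))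
    (hs : ∀ x y, M.Holds Fin.elim0 θ (Fin.cons y (Fin.cons x v)) →
      ∃ y, M.Holds Fin.elim0 θ (Fin.cons y (Fin.cons (x + 1) v))) (x : M.Num) :
    ∃ y, M.Holds Fin.elim0 θ (Fin.cons y (Fin.cons x v)) :=
  hM.induction 0 n θ Fin.elim0 v (fun i => i.elim0) ⟨0, h0⟩ (fun x ⟨y, hy⟩ => hs x y hy) x

/-- Induction for an equation between terms. -/
theorem eqInduction (hM : M.ModelsRCA₀) {n : ℕ} (s t : NumTerm (n + 2)) (v : Fin n → M.Num)
    (h0 : M.termValue (Fin.cons 0 (Fin.cons 0 v)) s = M.termValue (Fin.cons 0 (Fin.cons 0 v)) t)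
    (hs : ∀ x y, M.termValue (Fin.cons y (Fin.cons x v)) s =
        M.termValue (Fin.cons y (Fin.cons x v)) t →
      ∃ y, M.termValue (Fin.cons y (Fin.cons (x + 1) v)) s =
        M.termValue (Fin.cons y (Fin.cons (x + 1) v)) t) (x : M.Num) :
    ∃ y, M.termValue (Fin.cons y (Fin.cons x v)) s = M.termValue (Fin.cons y (Fin.cons x v)) t :=
  hM.bddInduction (.eq s t) v h0 hs x

theorem zero_add (hM : M.ModelsRCA₀) (a : M.Num) : 0 + a = a := by
  -- Variable `0` is the existential witness, which an identity ignores; variable `1` is the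
  -- induction variable and parameters start at `2`.
  have := hM.eqInduction (n := 0) (.add .zero (.var 1)) (.var 1) ![]
    (hM.basic.add_zero _)
    (fun x y h => ⟨y, by
      change 0 + (x + 1) = x + 1
      rw [hM.basic.add_succ]; exact congrArg (· + 1) h⟩) a
  exact this.choose_spec

theorem succ_add (hM : M.ModelsRCA₀) (a b : M.Num) : a + 1 + b = a + b + 1 := by
  have := hM.eqInduction (n := 1) (.add (.add (.var 2) .one) (.var 1))
    (.add (.add (.var 2) (.var 1)) .one) ![a]
    (by change a + 1 + 0 = a + 0 + 1
        rw [hM.basic.add_zero, hM.basic.add_zero])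
    (fun x y h => ⟨y, by
      change a + 1 + (x + 1) = a + (x + 1) + 1
      rw [hM.basic.add_succ, hM.basic.add_succ]; exact congrArg (· + 1) h⟩) b
  exact this.choose_spec

theorem add_comm (hM : M.ModelsRCA₀) (a b : M.Num) : a + b = b + a := by
  have := hM.eqInduction (n := 1) (.add (.var 2) (.var 1)) (.add (.var 1) (.var 2)) ![a]
    (by change a + 0 = 0 + a
        rw [hM.basic.add_zero, hM.zero_add])
    (fun x y h => ⟨y, by
      change a + (x + 1) = x + 1 + a
      rw [hM.basic.add_succ, hM.succ_add]; exact congrArg (· + 1) h⟩) b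
  exact this.choose_spec

theorem add_assoc (hM : M.ModelsRCA₀) (a b c : M.Num) : a + b + c = a + (b + c) := by
  have := hM.eqInduction (n := 2) (.add (.add (.var 2) (.var 3)) (.var 1))
    (.add (.var 2) (.add (.var 3) (.var 1))) ![a, b]
    (by change a + b + 0 = a + (b + 0)
        rw [hM.basic.add_zero, hM.basic.add_zero])
    (fun x y h => ⟨y, by
      change a + b + (x + 1) = a + (b + (x + 1))
      rw [hM.basic.add_succ, hM.basic.add_succ, hM.basic.add_succ]
      exact congrArg (· + 1) h⟩) c
  exact this.choose_spec

theorem zero_mul (hM : M.ModelsRCA₀) (a : M.Num) : 0 * a = 0 := by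
  have := hM.eqInduction (n := 0) (.mul .zero (.var 1)) .zero ![]
    (hM.basic.mul_zero _)
    (fun x y h => ⟨y, by
      change 0 * (x + 1) = 0
      rw [hM.basic.mul_succ, hM.basic.add_zero]; exact h⟩) a
  exact this.choose_spec

theorem succ_mul (hM : M.ModelsRCA₀) (a b : M.Num) : (a + 1) * b = a * b + b := by
  have := hM.eqInduction (n := 1) (.mul (.add (.var 2) .one) (.var 1))
    (.add (.mul (.var 2) (.var 1)) (.var 1)) ![a]
    (by change (a + 1) * 0 = a * 0 + 0
        rw [hM.basic.mul_zero, hM.basic.mul_zero, hM.basic.add_zero])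
    (fun x y h => ⟨y, by
      change (a + 1) * (x + 1) = a * (x + 1) + (x + 1)
      have h : (a + 1) * x = a * x + x := h
      rw [hM.basic.mul_succ, hM.basic.mul_succ, h, hM.basic.add_succ, hM.basic.add_succ,
        hM.add_assoc (a * x) x a, hM.add_comm x a, ← hM.add_assoc]⟩) b
  exact this.choose_spec

theorem mul_comm (hM : M.ModelsRCA₀) (a b : M.Num) : a * b = b * a := by
  have := hM.eqInduction (n := 1) (.mul (.var 2) (.var 1)) (.mul (.var 1) (.var 2)) ![a]
    (by change a * 0 = 0 * a
        rw [hM.basic.mul_zero, hM.zero_mul])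
    (fun x y h => ⟨y, by
      change a * (x + 1) = (x + 1) * a
      rw [hM.basic.mul_succ, hM.succ_mul]; exact congrArg (· + a) h⟩) b
  exact this.choose_spec

theorem mul_add (hM : M.ModelsRCA₀) (a b c : M.Num) : a * (b + c) = a * b + a * c := by
  have := hM.eqInduction (n := 2) (.mul (.var 2) (.add (.var 3) (.var 1)))
    (.add (.mul (.var 2) (.var 3)) (.mul (.var 2) (.var 1))) ![a, b]
    (by change a * (b + 0) = a * b + a * 0
        rw [hM.basic.add_zero, hM.basic.mul_zero, hM.basic.add_zero])
    (fun x y h => ⟨y, by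
      change a * (b + (x + 1)) = a * b + a * (x + 1)
      have h : a * (b + x) = a * b + a * x := h
      rw [hM.basic.add_succ, hM.basic.mul_succ, hM.basic.mul_succ, h, hM.add_assoc]⟩) c
  exact this.choose_spec

theorem mul_assoc (hM : M.ModelsRCA₀) (a b c : M.Num) : a * b * c = a * (b * c) := by
  have := hM.eqInduction (n := 2) (.mul (.mul (.var 2) (.var 3)) (.var 1))
    (.mul (.var 2) (.mul (.var 3) (.var 1))) ![a, b]
    (by change a * b * 0 = a * (b * 0)
        rw [hM.basic.mul_zero, hM.basic.mul_zero, hM.basic.mul_zero])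
    (fun x y h => ⟨y, by
      change a * b * (x + 1) = a * (b * (x + 1))
      have h : a * b * x = a * (b * x) := h
      rw [hM.basic.mul_succ, hM.basic.mul_succ, h, hM.mul_add]⟩) c
  exact this.choose_spec

theorem add_right_cancel (hM : M.ModelsRCA₀) (a b c : M.Num) (h : a + c = b + c) : a = b := by
  by_contra hab
  -- Injectivity of the successor propagates the inequality `a + x ≠ b + x` upwards from `a ≠ b`.
  have := hM.bddInduction (n := 2)
    (.neg (.eq (.add (.var 2) (.var 1)) (.add (.var 3) (.var 1)))) ![a, b]
    (by change ¬ a + 0 = b + 0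
        rwa [hM.basic.add_zero, hM.basic.add_zero])
    (fun x y h => ⟨y, by
      change ¬ a + (x + 1) = b + (x + 1)
      rw [hM.basic.add_succ, hM.basic.add_succ]
      exact fun e => h (hM.basic.succ_inj _ _ e)⟩) c
  exact this.choose_spec h

/-- The axioms describe `<` only by recursion on its right argument. Here the witness of the `Σ⁰₁`
induction is really used: it is the difference. The order structure below rests on this additive
form. -/
theorem lt_iff_exists_add_succ (hM : M.ModelsRCA₀) (a b : M.Num) :
    a < b ↔ ∃ c, a + c + 1 = b := by
  constructor
  · intro hab
    have := hM.bddInduction (n := 1)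
      (.or (.neg (.lt (.var 2) (.var 1))) (.eq (.add (.add (.var 2) (.var 0)) .one) (.var 1))) ![a]
      (Or.inl (hM.basic.not_lt_zero a))
      (fun x y h => by
        have h : ¬ a < x ∨ a + y + 1 = x := h
        by_cases hx : a < x + 1
        · rcases (hM.basic.lt_succ_iff _ _).1 hx with h1 | rfl
          · refine ⟨y + 1, Or.inr ?_⟩
            change a + (y + 1) + 1 = x + 1
            rw [hM.basic.add_succ, h.resolve_left (not_not.2 h1)]
          · refine ⟨0, Or.inr ?_⟩
            change a + 0 + 1 = a + 1
            rw [hM.basic.add_zero]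
        · exact ⟨0, Or.inl hx⟩) b
    obtain ⟨y, hy⟩ := this
    exact ⟨y, hy.resolve_left (not_not.2 hab)⟩
  · rintro ⟨c, rfl⟩
    have := hM.bddInduction (n := 1) (.lt (.var 2) (.add (.add (.var 2) (.var 1)) .one)) ![a]
      (by change a < a + 0 + 1
          rw [hM.basic.add_zero, hM.basic.lt_succ_iff]; exact Or.inr rfl)
      (fun x y h => ⟨y, by
        change a < a + (x + 1) + 1
        rw [hM.basic.lt_succ_iff, hM.basic.add_succ]; exact Or.inl h⟩) c
    exact this.choose_spec

theorem eq_zero_or_succ (hM : M.ModelsRCA₀) (a : M.Num) : a = 0 ∨ ∃ b, a = b + 1 := by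
  obtain ⟨b, hb⟩ := hM.bddInduction (n := 0)
    (.or (.eq (.var 1) .zero) (.eq (.var 1) (.add (.var 0) .one))) ![]
    (Or.inl rfl) (fun x y h => ⟨x, Or.inr rfl⟩) a
  exact hb.imp id fun h => ⟨b, h⟩

theorem lt_trichotomy (hM : M.ModelsRCA₀) (a b : M.Num) : a < b ∨ a = b ∨ b < a := by
  obtain ⟨_, hb⟩ := hM.bddInduction (n := 1)
    (.or (.lt (.var 2) (.var 1)) (.or (.eq (.var 2) (.var 1)) (.lt (.var 1) (.var 2)))) ![a]
    (by
      change a < 0 ∨ a = 0 ∨ 0 < a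
      rcases hM.eq_zero_or_succ a with rfl | ⟨b, rfl⟩
      · exact Or.inr (Or.inl rfl)
      · exact Or.inr (Or.inr ((hM.lt_iff_exists_add_succ _ _).2 ⟨b, by rw [hM.zero_add]⟩)))
    (fun x y h => ⟨y, by
      change a < x + 1 ∨ a = x + 1 ∨ x + 1 < a
      have h : a < x ∨ a = x ∨ x < a := h
      rcases h with h | h | h
      · exact Or.inl ((hM.basic.lt_succ_iff _ _).2 (Or.inl h))
      · exact Or.inl ((hM.basic.lt_succ_iff _ _).2 (Or.inr h))
      · obtain ⟨c, rfl⟩ := (hM.lt_iff_exists_add_succ _ _).1 h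
        rcases hM.eq_zero_or_succ c with rfl | ⟨d, rfl⟩
        · exact Or.inr (Or.inl (by rw [hM.basic.add_zero]))
        · refine Or.inr (Or.inr ((hM.lt_iff_exists_add_succ _ _).2 ⟨d, ?_⟩))
          rw [hM.basic.add_succ, hM.succ_add]⟩) b
  exact hb

end ModelsRCA₀

theorem modelsRCA₀ [h : Fact M.ModelsRCA₀] : M.ModelsRCA₀ := h.out

variable [Fact M.ModelsRCA₀]

/-! ### The numbers as an ordered commutative semiring. -/

instance : CommSemiring M.Num where
  add := (· + ·)
  mul := (· * ·)
  zero := 0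
  one := 1
  add_assoc := modelsRCA₀.add_assoc
  zero_add := modelsRCA₀.zero_add
  add_zero := modelsRCA₀.basic.add_zero
  add_comm := modelsRCA₀.add_comm
  left_distrib := modelsRCA₀.mul_add
  right_distrib a b c := by
    rw [modelsRCA₀.mul_comm, modelsRCA₀.mul_add, modelsRCA₀.mul_comm c, modelsRCA₀.mul_comm c]
  zero_mul := modelsRCA₀.zero_mul
  mul_zero := modelsRCA₀.basic.mul_zero
  mul_assoc := modelsRCA₀.mul_assoc
  one_mul a := by
    conv_lhs => rw [← modelsRCA₀.zero_add (1 : M.Num)]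
    rw [modelsRCA₀.succ_mul, modelsRCA₀.zero_mul, modelsRCA₀.zero_add]
  mul_one a := by
    conv_lhs => rw [← modelsRCA₀.zero_add (1 : M.Num)]
    rw [modelsRCA₀.basic.mul_succ, modelsRCA₀.basic.mul_zero, modelsRCA₀.zero_add]
  mul_comm := modelsRCA₀.mul_comm
  nsmul := nsmulRec

theorem lt_iff_exists_add_succ {a b : M.Num} : a < b ↔ ∃ c, a + c + 1 = b :=
  modelsRCA₀.lt_iff_exists_add_succ a b

instance : IsRightCancelAdd M.Num where
  add_right_cancel c a b h := modelsRCA₀.add_right_cancel a b c h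

instance : IsLeftCancelAdd M.Num where
  add_left_cancel c a b h := modelsRCA₀.add_right_cancel a b c (by rwa [add_comm a, add_comm b])

noncomputable instance : LinearOrder M.Num :=
  have irrefl (a : M.Num) : ¬ a < a := fun h => by
    obtain ⟨c, hc⟩ := lt_iff_exists_add_succ.1 h
    rw [add_assoc] at hc
    exact modelsRCA₀.basic.succ_ne_zero c (add_eq_left.1 hc)
  have trans (a b c : M.Num) : a < b → b < c → a < c := fun h1 h2 => by
    obtain ⟨d, rfl⟩ := lt_iff_exists_add_succ.1 h1
    obtain ⟨e, rfl⟩ := lt_iff_exists_add_succ.1 h2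
    exact lt_iff_exists_add_succ.2 ⟨d + 1 + e, by ring⟩
  { le := fun a b => a < b ∨ a = b
    lt := (· < ·)
    le_refl := fun a => Or.inr rfl
    le_trans := by
      rintro a b c (h1 | rfl) (h2 | rfl)
      · exact Or.inl (trans _ _ _ h1 h2)
      · exact Or.inl h1
      · exact Or.inl h2
      · exact Or.inr rfl
    lt_iff_le_not_ge := fun a b => by
      constructor
      · rintro h
        refine ⟨Or.inl h, ?_⟩
        rintro (h' | rfl)
        · exact irrefl _ (trans _ _ _ h h')
        · exact irrefl _ h
      · rintro ⟨h | rfl, h'⟩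
        · exact h
        · exact absurd (Or.inr rfl) h'
    le_antisymm := by
      rintro a b (h1 | rfl) (h2 | h2)
      · exact absurd (trans _ _ _ h1 h2) (irrefl _)
      · exact h2.symm
      · rfl
      · rfl
    le_total := fun a b => by
      rcases modelsRCA₀.lt_trichotomy a b with h | h | h
      · exact Or.inl (Or.inl h)
      · exact Or.inl (Or.inr h)
      · exact Or.inr (Or.inl h)
    toDecidableLE := Classical.decRel _ }

theorem lt_add_one_iff {a b : M.Num} : a < b + 1 ↔ a ≤ b := modelsRCA₀.basic.lt_succ_iff a b

theorem le_iff_exists_add {a b : M.Num} : a ≤ b ↔ ∃ c, b = a + c := by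
  rw [← lt_add_one_iff, lt_iff_exists_add_succ]
  exact exists_congr fun c => by rw [add_left_inj, eq_comm]

instance : IsOrderedAddMonoid M.Num where
  add_le_add_left a b h c := by
    obtain ⟨d, rfl⟩ := le_iff_exists_add.1 h
    exact le_iff_exists_add.2 ⟨d, by ring⟩

instance : CanonicallyOrderedAdd M.Num where
  exists_add_of_le h := le_iff_exists_add.1 h
  le_add_self a b := le_iff_exists_add.2 ⟨b, by ring⟩
  le_self_add a b := le_iff_exists_add.2 ⟨b, rfl⟩

instance : Nontrivial M.Num :=
  ⟨1, 0, by simpa using modelsRCA₀.basic.succ_ne_zero (0 : M.Num)⟩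

instance : SuccAddOrder M.Num where
  succ a := a + 1
  le_succ a := le_self_add
  max_of_succ_le {a} h := absurd (lt_add_one_iff.2 le_rfl) (not_lt.2 h)
  succ_le_of_lt {a b} h := by
    obtain ⟨c, rfl⟩ := lt_iff_exists_add_succ.1 h
    exact le_iff_exists_add.2 ⟨c, by ring⟩
  succ_eq_add_one a := rfl

instance : NoMaxOrder M.Num where
  exists_gt a := ⟨a + 1, lt_add_one_iff.2 le_rfl⟩

instance : IsOrderedCancelAddMonoid M.Num where
  le_of_add_le_add_left a b c h := by
    obtain ⟨d, hd⟩ := le_iff_exists_add.1 h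
    rw [add_assoc, add_right_inj] at hd
    exact le_iff_exists_add.2 ⟨d, hd⟩

instance : IsStrictOrderedRing M.Num :=
  have pos {a b : M.Num} (ha : 0 < a) (hb : 0 < b) : 0 < a * b := by
    obtain ⟨c, rfl⟩ := lt_iff_exists_add_succ.1 ha
    obtain ⟨d, rfl⟩ := lt_iff_exists_add_succ.1 hb
    exact lt_iff_exists_add_succ.2 ⟨c * d + c + d, by ring⟩
  { zero_le_one := zero_le
    mul_lt_mul_of_pos_left := fun a ha b c hbc => by
      obtain ⟨d, rfl⟩ := lt_iff_exists_add_succ.1 hbc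
      have := pos ha (b := d + 1) (lt_add_one_iff.2 zero_le)
      rw [add_assoc, mul_add]
      exact lt_add_of_pos_right _ this
    mul_lt_mul_of_pos_right := fun a ha b c hbc => by
      obtain ⟨d, rfl⟩ := lt_iff_exists_add_succ.1 hbc
      have := pos (a := d + 1) (lt_add_one_iff.2 zero_le) ha
      rw [add_assoc, add_mul]
      exact lt_add_of_pos_right _ this }

end Arithmetic

section Pairing

variable {M : L2Structure.{u}} [Fact M.ModelsRCA₀]

/-! ### The Cantor pairing bijection -/

/-- A bijective pairing is needed so that every number codes a pair, and `pair` is not onto. Halves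
of `s * (s + 1)` are found by induction, and identities about them are verified after doubling,
through `add_self_inj`. -/
theorem exists_triangular (s : M.Num) : ∃ t, t + t = s * (s + 1) :=
  modelsRCA₀.eqInduction (n := 0) (.add (.var 0) (.var 0)) (.mul (.var 1) (.add (.var 1) .one)) ![]
    (by change (0 : M.Num) + 0 = 0 * (0 + 1); ring)
    (fun x y h => ⟨y + x + 1, by
      change y + x + 1 + (y + x + 1) = (x + 1) * (x + 1 + 1)
      have h : y + y = x * (x + 1) := h
      calc y + x + 1 + (y + x + 1) = (y + y) + (x + 1 + (x + 1)) := by ring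
        _ = _ := by rw [h]; ring⟩) s

/-- The `s`-th triangular number. -/
noncomputable def triangular (s : M.Num) : M.Num := (exists_triangular s).choose

theorem triangular_add_self (s : M.Num) : triangular s + triangular s = s * (s + 1) :=
  (exists_triangular s).choose_spec

theorem add_self_inj {a b : M.Num} : a + a = b + b ↔ a = b :=
  ⟨fun h => by
    rcases lt_trichotomy a b with h' | h' | h'
    · exact absurd h (add_lt_add h' h').ne
    · exact h'
    · exact absurd h (add_lt_add h' h').ne', fun h => h ▸ rfl⟩

theorem triangular_succ (s : M.Num) : triangular (s + 1) = triangular s + (s + 1) := by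
  rw [← add_self_inj, triangular_add_self, add_add_add_comm, triangular_add_self]
  ring

theorem triangular_mono {s t : M.Num} (h : s ≤ t) : triangular s ≤ triangular t := by
  by_contra! h'
  have h2 := add_lt_add h' h'
  rw [triangular_add_self, triangular_add_self] at h2
  exact absurd (mul_le_mul' h (add_le_add_left h 1)) (not_le.2 h2)

/-- The Cantor pairing function. -/
noncomputable def cpair (x y : M.Num) : M.Num := triangular (x + y) + x

/-- The doubled equation is between polynomials, hence expressible by terms. -/
theorem cpair_eq_iff {x y z : M.Num} :
    z = cpair x y ↔ z + z = (x + y) * (x + y + 1) + (x + x) := by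
  rw [← triangular_add_self, add_add_add_comm, add_self_inj, cpair]

/-- This is the passage from the end of one diagonal to the start of the next; `cpair_succ_left` is
a step along a diagonal. Together they drive the induction in `exists_cpair`. -/
theorem cpair_zero_succ (x : M.Num) : cpair 0 (x + 1) = cpair x 0 + 1 := by
  rw [cpair, cpair, zero_add, add_zero, add_zero, triangular_succ, add_assoc]

theorem cpair_succ_left (x y : M.Num) : cpair (x + 1) y = cpair x (y + 1) + 1 := by
  rw [cpair, cpair, add_right_comm x 1 y, ← add_assoc x y 1, add_assoc _ x 1]

theorem left_le_cpair (x y : M.Num) : x ≤ cpair x y := le_add_self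

theorem le_triangular (x : M.Num) : x ≤ triangular x := by
  by_contra! h
  have h2 := add_lt_add h h
  rw [triangular_add_self] at h2
  rcases eq_or_ne x 0 with rfl | hx
  · simp at h2
  · have : x * (1 + 1) ≤ x * (x + 1) :=
      mul_le_mul' le_rfl (add_le_add_left (Order.one_le_iff_pos.2 (pos_iff_ne_zero.2 hx)) 1)
    rw [mul_add, mul_one] at this
    exact absurd this (not_le.2 h2)

theorem right_le_cpair (x y : M.Num) : y ≤ cpair x y :=
  (le_add_self.trans (le_triangular (x + y))).trans le_self_add

theorem cpair_inj {x y x' y' : M.Num} (h : cpair x y = cpair x' y') : x = x' ∧ y = y' := by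
  -- The diagonal of sum `s` occupies the interval from `triangular s` up to, but excluding,
  -- `triangular (s + 1)`.
  have key : ∀ {x y x' y' : M.Num}, x + y < x' + y' → cpair x y < cpair x' y' := by
    intro x y x' y' h
    calc cpair x y ≤ triangular (x + y) + (x + y) := add_le_add_right le_self_add _
      _ < triangular (x + y) + (x + y) + 1 := lt_add_one_iff.2 le_rfl
      _ = triangular (x + y + 1) := by rw [triangular_succ, add_assoc]
      _ ≤ triangular (x' + y') := triangular_mono (Order.add_one_le_iff.2 h)
      _ ≤ cpair x' y' := le_self_add
  rcases lt_trichotomy (x + y) (x' + y') with h' | h' | h'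
  · exact absurd h (key h').ne
  · rw [cpair, cpair, h', add_right_inj] at h
    subst h
    exact ⟨rfl, add_left_cancel h'⟩
  · exact absurd h (key h').ne'

theorem exists_cpair (z : M.Num) : ∃ x y, cpair x y = z := by
  -- The single unbounded witness `w` bounds both components, so the matrix has only bounded
  -- quantifiers.
  obtain ⟨w, x, -, y, -, h⟩ := modelsRCA₀.bddInduction (n := 0)
    (.bex (.add (.var 0) .one) (.bex (.add (.var 1) .one) (.eq (.add (.var 3) (.var 3))
      (.add (.mul (.add (.var 1) (.var 0)) (.add (.add (.var 1) (.var 0)) .one))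
        (.add (.var 1) (.var 1)))))) ![]
    (by
      change ∃ x : M.Num, x < 0 + 1 ∧ ∃ y : M.Num, y < 0 + 1 ∧
        (0 : M.Num) + 0 = (x + y) * (x + y + 1) + (x + x)
      exact ⟨0, by simp, 0, by simp, by simp⟩)
    (fun z w h => by
      change ∃ w, ∃ x, x < w + 1 ∧ ∃ y, y < w + 1 ∧
        z + 1 + (z + 1) = (x + y) * (x + y + 1) + (x + x)
      obtain ⟨x, -, y, -, h⟩ : ∃ x, x < w + 1 ∧ ∃ y, y < w + 1 ∧
        z + z = (x + y) * (x + y + 1) + (x + x) := h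
      simp_rw [lt_add_one_iff, ← cpair_eq_iff] at h ⊢
      subst h
      rcases modelsRCA₀.eq_zero_or_succ y with rfl | ⟨y, rfl⟩
      · exact ⟨x + 1, 0, zero_le, x + 1, le_rfl, (cpair_zero_succ x).symm⟩
      · exact ⟨x + y + 1, x + 1, add_le_add_left le_self_add 1, y,
          by rw [add_assoc]; exact le_add_left le_self_add, (cpair_succ_left x y).symm⟩) z
  exact ⟨x, y, (cpair_eq_iff.2 h).symm⟩

/-- The left component of a number under Cantor pairing. -/
noncomputable def cfst (z : M.Num) : M.Num := (exists_cpair z).choose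

/-- The right component of a number under Cantor pairing. -/
noncomputable def csnd (z : M.Num) : M.Num := (exists_cpair z).choose_spec.choose

theorem cpair_cfst_csnd (z : M.Num) : cpair (cfst z) (csnd z) = z :=
  (exists_cpair z).choose_spec.choose_spec

theorem cfst_cpair (x y : M.Num) : cfst (cpair x y) = x := (cpair_inj (cpair_cfst_csnd _)).1

theorem csnd_cpair (x y : M.Num) : csnd (cpair x y) = y := (cpair_inj (cpair_cfst_csnd _)).2

end Pairing

end L2Structure

/-! ### Formulas about pairs -/

namespace BddFormula

/-- The formula `∃ x y, xᵢ = ⟨x, y⟩ ∧ φ`; in `φ` the variable `0` is `y` and the variable `1` is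
`x`. -/
def unpair {k n : ℕ} (i : Fin n) (φ : BddFormula k (n + 2)) : BddFormula k n :=
  .bex (.add (.var i) .one) (.bex (.add (.var i.succ) .one)
    (.and (.eq (.add (.var i.succ.succ) (.var i.succ.succ))
      (.add (.mul (.add (.var 1) (.var 0)) (.add (.add (.var 1) (.var 0)) .one))
        (.add (.var 1) (.var 1)))) φ))

/-- The formula `⟨xᵢ, xⱼ⟩ ∈ X`. -/
def pairMem {k n : ℕ} (i j : Fin n) (X : Fin k) : BddFormula k n :=
  -- The code itself is not a term, since it involves halving; twice the code plus one is a term and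
  -- bounds it.
  .bex (.add (.add (.mul (.add (.var i) (.var j)) (.add (.add (.var i) (.var j)) .one))
      (.add (.var i) (.var i))) .one)
    (.and (.eq (.add (.var 0) (.var 0))
      (.add (.mul (.add (.var i.succ) (.var j.succ)) (.add (.add (.var i.succ) (.var j.succ)) .one))
        (.add (.var i.succ) (.var i.succ)))) (.mem (.var 0) X))

end BddFormula

namespace L2Structure

section Computability

variable {M : L2Structure.{u}} [Fact M.ModelsRCA₀]

theorem holds_unpair {k n : ℕ} {A : Fin k → Set M.Num} {i : Fin n} {φ : BddFormula k (n + 2)}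
    {v : Fin n → M.Num} :
    M.Holds A (.unpair i φ) v ↔ M.Holds A φ (Fin.cons (csnd (v i)) (Fin.cons (cfst (v i)) v)) := by
  change (∃ x, x < v i + 1 ∧ ∃ y, y < v i + 1 ∧
    (v i + v i = (x + y) * (x + y + 1) + (x + x) ∧ M.Holds A φ (Fin.cons y (Fin.cons x v)))) ↔ _
  simp_rw [← cpair_eq_iff]
  constructor
  · rintro ⟨x, -, y, -, h, h'⟩
    rwa [h, cfst_cpair, csnd_cpair]
  · intro h
    refine ⟨_, lt_add_one_iff.2 ?_, _, lt_add_one_iff.2 ?_, (cpair_cfst_csnd (v i)).symm, h⟩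
    · conv_rhs => rw [← cpair_cfst_csnd (v i)]
      exact left_le_cpair _ _
    · conv_rhs => rw [← cpair_cfst_csnd (v i)]
      exact right_le_cpair _ _

theorem holds_pairMem {k n : ℕ} {A : Fin k → Set M.Num} {i j : Fin n} {X : Fin k}
    {v : Fin n → M.Num} : M.Holds A (.pairMem i j X) v ↔ cpair (v i) (v j) ∈ A X := by
  change (∃ z, z < (v i + v j) * (v i + v j + 1) + (v i + v i) + 1 ∧
    (z + z = (v i + v j) * (v i + v j + 1) + (v i + v i) ∧ z ∈ A X)) ↔ _
  constructor
  · rintro ⟨z, -, h, h'⟩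
    rwa [← cpair_eq_iff.2 h]
  · intro h
    refine ⟨_, ?_, cpair_eq_iff.1 rfl, h⟩
    rw [← cpair_eq_iff.1 rfl, lt_add_one_iff]
    exact le_self_add

/-! ### Decidable predicates and computable functions of a model -/

variable (M) in
/-- A type whose elements are coded by the numbers of the model. -/
class Coded (α : Type u) where
  code : α ≃ M.Num

instance : Coded M M.Num := ⟨Equiv.refl _⟩

noncomputable instance {α β : Type u} [Coded M α] [Coded M β] : Coded M (α × β) where
  code :=
    { toFun := fun q => cpair (Coded.code q.1) (Coded.code q.2)
      invFun := fun z => (Coded.code.symm (cfst z), Coded.code.symm (csnd z))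
      left_inv := fun q => by simp [cfst_cpair, csnd_cpair]
      right_inv := fun z => by simp [cpair_cfst_csnd] }

theorem code_symm_prod {α β : Type u} [Coded M α] [Coded M β] (z : M.Num) :
    (Coded.code.symm z : α × β) = (Coded.code.symm (cfst z), Coded.code.symm (csnd z)) := rfl

variable {α β γ : Type u} [Coded M α] [Coded M β] [Coded M γ]

variable (M) in
/-- The set of codes of the elements with the property `p`. -/
def codes (p : α → Prop) : Set M.Num := {x | p (Coded.code.symm x)}

variable (M) in
/-- The predicate `p` is given by a set of the model. -/
def Pr (p : α → Prop) : Prop := M.codes p ∈ M.sets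

theorem cpair_mem_codes {p : α × β → Prop} {x y : M.Num} :
    cpair x y ∈ M.codes p ↔ p (Coded.code.symm x, Coded.code.symm y) := by
  rw [codes, Set.mem_ofPred_eq, code_symm_prod, cfst_cpair, csnd_cpair]

variable (M) in
/-- The function `f` is given by a set of the model. -/
def Fn (f : α → β) : Prop := M.Pr fun q : α × β => f q.1 = q.2

omit [Fact M.ModelsRCA₀] in
theorem Pr.of_iff {p q : α → Prop} (hp : M.Pr p) (h : ∀ a, q a ↔ p a) : M.Pr q := by
  rwa [show q = p from funext fun a => propext (h a)]

/-- The set defined by a bounded formula in which the variable `0` does not matter. -/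
theorem setOf_mem_sets {k n : ℕ} (θ : BddFormula k (n + 2)) (A : Fin k → Set M.Num)
    (hA : ∀ i, A i ∈ M.sets) (v : Fin n → M.Num) {p : M.Num → Prop}
    (h : ∀ y x, M.Holds A θ (Fin.cons y (Fin.cons x v)) ↔ p x) : {x | p x} ∈ M.sets := by
  obtain ⟨X, hX, hX'⟩ := (modelsRCA₀ (M := M)).comprehension k n θ θ A v hA
    (fun x => by simp [h])
  convert hX using 1
  ext x
  simp [hX', h]

theorem Pr.not {p : α → Prop} (hp : M.Pr p) : M.Pr fun a => ¬ p a :=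
  setOf_mem_sets (n := 0) (.neg (.mem (.var 1) 0)) ![_]
    (by rw [Fin.forall_fin_one]; exact hp) ![] fun _ _ => Iff.rfl

theorem Pr.and {p q : α → Prop} (hp : M.Pr p) (hq : M.Pr q) : M.Pr fun a => p a ∧ q a :=
  setOf_mem_sets (n := 0) (.and (.mem (.var 1) 0) (.mem (.var 1) 1)) ![_, _]
    (by rw [Fin.forall_fin_two]; exact ⟨hp, hq⟩) ![] fun _ _ => Iff.rfl

theorem Pr.or {p q : α → Prop} (hp : M.Pr p) (hq : M.Pr q) : M.Pr fun a => p a ∨ q a :=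
  (hp.not.and hq.not).not.of_iff fun a => by tauto

theorem Pr.imp {p q : α → Prop} (hp : M.Pr p) (hq : M.Pr q) : M.Pr fun a => p a → q a :=
  (hp.and hq.not).not.of_iff fun a => by tauto

theorem Pr.iff {p q : α → Prop} (hp : M.Pr p) (hq : M.Pr q) : M.Pr fun a => (p a ↔ q a) :=
  ((hp.imp hq).and (hq.imp hp)).of_iff fun a => by tauto

/-- Comprehension for `Δ⁰₁` predicates. -/
theorem Pr.of_exists_forall {p : α → Prop} {q r : α × β → Prop} (hq : M.Pr q) (hr : M.Pr r)
    (h : ∀ a, p a ↔ ∃ b, q (a, b)) (h' : ∀ a, p a ↔ ∀ b, r (a, b)) : M.Pr p := by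
  have e1 (x : M.Num) : p (Coded.code.symm x) ↔ ∃ y, cpair x y ∈ M.codes q := by
    simp_rw [h, cpair_mem_codes]
    exact (Coded.code (M := M) (α := β)).symm.surjective.exists
  have e2 (x : M.Num) : p (Coded.code.symm x) ↔ ∀ y, cpair x y ∈ M.codes r := by
    simp_rw [h', cpair_mem_codes]
    exact (Coded.code (M := M) (α := β)).symm.surjective.forall
  obtain ⟨X, hX, hX'⟩ := (modelsRCA₀ (M := M)).comprehension 2 0 (.pairMem 1 0 0) (.pairMem 1 0 1)
    ![_, _] ![] (by rw [Fin.forall_fin_two]; exact ⟨hq, hr⟩)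
    (fun x => by simp only [holds_pairMem]; exact (e1 x).symm.trans (e2 x))
  unfold Pr
  convert hX using 1
  ext x
  simp only [hX', holds_pairMem]
  exact e1 x

theorem Pr.snd {p : β → Prop} (hp : M.Pr p) : M.Pr fun q : α × β => p q.2 :=
  setOf_mem_sets (n := 0) (.unpair 1 (.mem (.var 0) 0)) ![_]
    (by rw [Fin.forall_fin_one]; exact hp) ![]
    fun _ _ => holds_unpair

/-- The condition is both `∃ b, f a = b ∧ p b` and `∀ b, f a = b → p b`, hence `Δ⁰₁`. -/
theorem Pr.comp {p : β → Prop} {f : α → β} (hp : M.Pr p) (hf : M.Fn f) : M.Pr fun a => p (f a) :=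
  Pr.of_exists_forall (Pr.and hf hp.snd) (Pr.imp hf hp.snd) (fun a => by simp) (fun a => by simp)

theorem Fn.id : M.Fn fun a : α => a :=
  (setOf_mem_sets (n := 0) (.unpair 1 (.eq (.var 1) (.var 0))) ![] (by simp) ![]
    fun _ _ => holds_unpair : {x : M.Num | cfst x = csnd x} ∈ M.sets) |> fun h => by
      unfold Fn Pr codes
      convert h using 3
      exact Coded.code.symm.injective.eq_iff

theorem Fn.const (b : β) : M.Fn fun _ : α => b :=
  (setOf_mem_sets (n := 1) (.unpair 1 (.eq (.var 4) (.var 0))) ![] (by simp) ![Coded.code b]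
    fun _ _ => holds_unpair : {x : M.Num | Coded.code b = csnd x} ∈ M.sets) |> fun h => by
      unfold Fn Pr codes
      convert h using 3
      exact (Equiv.eq_symm_apply _)

theorem Fn.fst : M.Fn fun q : α × β => q.1 :=
  (setOf_mem_sets (n := 0) (.unpair 1 (.unpair 1 (.eq (.var 1) (.var 2)))) ![] (by simp) ![]
    fun _ _ => holds_unpair.trans holds_unpair : {x : M.Num | cfst (cfst x) = csnd x} ∈ M.sets)
    |> fun h => by
      unfold Fn Pr codes
      convert h using 3
      exact Coded.code.symm.injective.eq_iff

theorem Fn.snd : M.Fn fun q : α × β => q.2 :=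
  (setOf_mem_sets (n := 0) (.unpair 1 (.unpair 1 (.eq (.var 0) (.var 2)))) ![] (by simp) ![]
    fun _ _ => holds_unpair.trans holds_unpair : {x : M.Num | csnd (cfst x) = csnd x} ∈ M.sets)
    |> fun h => by
      unfold Fn Pr codes
      convert h using 3
      exact Coded.code.symm.injective.eq_iff

theorem Fn.prodMk {f : α → β} {g : α → γ} (hf : M.Fn f) (hg : M.Fn g) :
    M.Fn fun a => (f a, g a) := by
  refine setOf_mem_sets (n := 0)
    (.unpair 1 (.unpair 0 (.and (.pairMem 3 1 0) (.pairMem 3 0 1))))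
    ![M.codes fun q : α × β => f q.1 = q.2, M.codes fun q : α × γ => g q.1 = q.2]
    (by rw [Fin.forall_fin_two]; exact ⟨hf, hg⟩) ![] fun y x => ?_
  rw [holds_unpair, holds_unpair, Holds, holds_pairMem, holds_pairMem]
  change cpair (cfst x) (cfst (csnd x)) ∈ M.codes (fun q : α × β => f q.1 = q.2) ∧
    cpair (cfst x) (csnd (csnd x)) ∈ M.codes (fun q : α × γ => g q.1 = q.2) ↔ _
  rw [cpair_mem_codes, cpair_mem_codes]
  simp [code_symm_prod]

/-- The two-sided description of `Pr.comp` is repeated on raw formulas, because rearranging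
coordinates by means of `Fn` would already require composing projections. -/
theorem Fn.comp {f : β → γ} {g : α → β} (hf : M.Fn f) (hg : M.Fn g) :
    M.Fn fun a => f (g a) := by
  let F := M.codes fun q : β × γ => f q.1 = q.2
  let G := M.codes fun q : α × β => g q.1 = q.2
  let θ : BddFormula 2 2 := .unpair 1 (.and (.pairMem 1 2 1) (.pairMem 2 0 0))
  let η : BddFormula 2 2 := .unpair 1 (.or (.neg (.pairMem 1 2 1)) (.pairMem 2 0 0))
  have e1 (x y : M.Num) : M.Holds ![F, G] θ (Fin.cons y (Fin.cons x ![])) ↔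
      g (Coded.code.symm (cfst x)) = Coded.code.symm y ∧
        f (Coded.code.symm y) = Coded.code.symm (csnd x) := by
    rw [holds_unpair, Holds, holds_pairMem, holds_pairMem]
    exact and_congr (cpair_mem_codes (p := fun q : α × β => g q.1 = q.2))
      (cpair_mem_codes (p := fun q : β × γ => f q.1 = q.2))
  have e2 (x y : M.Num) : M.Holds ![F, G] η (Fin.cons y (Fin.cons x ![])) ↔
      (g (Coded.code.symm (cfst x)) = Coded.code.symm y →
        f (Coded.code.symm y) = Coded.code.symm (csnd x)) := by
    rw [holds_unpair, Holds, Holds, holds_pairMem, holds_pairMem, imp_iff_not_or]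
    exact or_congr (not_congr (cpair_mem_codes (p := fun q : α × β => g q.1 = q.2)))
      (cpair_mem_codes (p := fun q : β × γ => f q.1 = q.2))
  have e3 (x : M.Num) : (∃ y, M.Holds ![F, G] θ (Fin.cons y (Fin.cons x ![]))) ↔
      f (g (Coded.code.symm (cfst x))) = Coded.code.symm (csnd x) := by
    simp_rw [e1]
    refine ((Coded.code (M := M) (α := β)).symm.surjective.exists (p := fun b =>
      g (Coded.code.symm (cfst x)) = b ∧ f b = Coded.code.symm (csnd x))).symm.trans ?_
    simp
  have e4 (x : M.Num) : (∀ y, M.Holds ![F, G] η (Fin.cons y (Fin.cons x ![]))) ↔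
      f (g (Coded.code.symm (cfst x))) = Coded.code.symm (csnd x) := by
    simp_rw [e2]
    refine ((Coded.code (M := M) (α := β)).symm.surjective.forall (p := fun b =>
      g (Coded.code.symm (cfst x)) = b → f b = Coded.code.symm (csnd x))).symm.trans ?_
    simp
  obtain ⟨X, hX, hX'⟩ := (modelsRCA₀ (M := M)).comprehension 2 0 θ η ![F, G] ![]
    (by rw [Fin.forall_fin_two]; exact ⟨hf, hg⟩) (fun x => (e3 x).trans (e4 x).symm)
  unfold Fn Pr
  convert hX using 1
  ext x
  exact ((hX' x).trans (e3 x)).symm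

theorem Fn.fst' {f : α → β × γ} (hf : M.Fn f) : M.Fn fun a => (f a).1 := Fn.fst.comp hf

theorem Fn.snd' {f : α → β × γ} (hf : M.Fn f) : M.Fn fun a => (f a).2 := Fn.snd.comp hf

theorem Fn.add {f g : α → M.Num} (hf : M.Fn f) (hg : M.Fn g) : M.Fn fun a => f a + g a := by
  have : M.Fn fun q : M.Num × M.Num => q.1 + q.2 :=
    setOf_mem_sets (n := 0) (.unpair 1 (.unpair 1 (.eq (.add (.var 1) (.var 0)) (.var 2)))) ![]
      (by simp) ![] fun _ _ => holds_unpair.trans holds_unpair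
  exact this.comp (hf.prodMk hg)

theorem Fn.mul {f g : α → M.Num} (hf : M.Fn f) (hg : M.Fn g) : M.Fn fun a => f a * g a := by
  have : M.Fn fun q : M.Num × M.Num => q.1 * q.2 :=
    setOf_mem_sets (n := 0) (.unpair 1 (.unpair 1 (.eq (.mul (.var 1) (.var 0)) (.var 2)))) ![]
      (by simp) ![] fun _ _ => holds_unpair.trans holds_unpair
  exact this.comp (hf.prodMk hg)

theorem Pr.eq {f g : α → β} (hf : M.Fn f) (hg : M.Fn g) : M.Pr fun a => f a = g a :=
  -- The diagonal of `β × β` is the graph of the identity.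
  Pr.comp (p := fun q : β × β => q.1 = q.2) Fn.id (hf.prodMk hg)

theorem Pr.lt {f g : α → M.Num} (hf : M.Fn f) (hg : M.Fn g) : M.Pr fun a => f a < g a := by
  have : M.Pr fun q : M.Num × M.Num => q.1 < q.2 :=
    setOf_mem_sets (n := 0) (.unpair 1 (.lt (.var 1) (.var 0))) ![] (by simp) ![]
      fun _ _ => holds_unpair
  exact this.comp (hf.prodMk hg)

theorem Pr.le {f g : α → M.Num} (hf : M.Fn f) (hg : M.Fn g) : M.Pr fun a => f a ≤ g a :=
  (Pr.lt hg hf).not.of_iff fun _ => not_lt.symm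

theorem Pr.mem {X : Set M.Num} (hX : X ∈ M.sets) {f : α → M.Num} (hf : M.Fn f) :
    M.Pr fun a => f a ∈ X :=
  Pr.comp (p := fun x => x ∈ X) hX hf

theorem Pr.ball {t : α → M.Num} {p : α → M.Num → Prop} (ht : M.Fn t)
    (hp : M.Pr fun q : α × M.Num => p q.1 q.2) : M.Pr fun a => ∀ y, y < t a → p a y := by
  have : M.Pr fun q : α × M.Num => ∀ y, y < q.2 → p q.1 y := by
    refine setOf_mem_sets (n := 0) (.unpair 1 (.ball (.var 0) (.pairMem 2 0 0)))
      ![M.codes fun q : α × M.Num => p q.1 q.2]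
      (by rw [Fin.forall_fin_one]; exact hp) ![] fun y x => ?_
    rw [holds_unpair, Holds]
    simp_rw [holds_pairMem]
    change (∀ z, z < csnd x → cpair (cfst x) z ∈
      M.codes fun q : α × M.Num => p q.1 q.2) ↔ _
    simp_rw [cpair_mem_codes]
    rfl
  exact this.comp (Fn.id.prodMk ht)

theorem Pr.bex {t : α → M.Num} {p : α → M.Num → Prop} (ht : M.Fn t)
    (hp : M.Pr fun q : α × M.Num => p q.1 q.2) : M.Pr fun a => ∃ y, y < t a ∧ p a y :=
  (Pr.ball (p := fun a y => ¬ p a y) ht hp.not).not.of_iff fun a => by push Not; rfl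

theorem Pr.ball_le {t : α → M.Num} {p : α → M.Num → Prop} (ht : M.Fn t)
    (hp : M.Pr fun q : α × M.Num => p q.1 q.2) : M.Pr fun a => ∀ y, y ≤ t a → p a y :=
  (Pr.ball (ht.add (.const 1)) hp).of_iff fun a => by simp

theorem Pr.bex_le {t : α → M.Num} {p : α → M.Num → Prop} (ht : M.Fn t)
    (hp : M.Pr fun q : α × M.Num => p q.1 q.2) : M.Pr fun a => ∃ y, y ≤ t a ∧ p a y :=
  (Pr.bex (ht.add (.const 1)) hp).of_iff fun a => by simp

/-- A relation that is the graph of a function of the model. -/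
theorem Fn.of_graph {f : α → β} {p : α → β → Prop} (hp : M.Pr fun q : α × β => p q.1 q.2)
    (h : ∀ a b, f a = b ↔ p a b) : M.Fn f :=
  hp.of_iff fun q => h q.1 q.2

/-! ### Induction -/

/-- Induction for `Σ⁰₁` predicates. -/
theorem sigmaInduction {p : M.Num → β → Prop}
    (hp : M.Pr fun q : M.Num × β => p q.1 q.2) (h0 : ∃ y, p 0 y)
    (hs : ∀ x y, p x y → ∃ z, p (x + 1) z) (x : M.Num) : ∃ y, p x y := by
  let X := M.codes fun q : M.Num × β => p q.1 q.2
  have e (x : M.Num) : (∃ y, M.Holds ![X] (.pairMem 1 0 0) (Fin.cons y (Fin.cons x ![]))) ↔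
      ∃ b, p x b := by
    simp_rw [holds_pairMem]
    rw [(Coded.code (M := M) (α := β)).symm.surjective.exists]
    exact exists_congr fun y => cpair_mem_codes (p := fun q : M.Num × β => p q.1 q.2)
  have := (modelsRCA₀ (M := M)).induction 1 0 (.pairMem 1 0 0) ![X] ![]
    (by rw [Fin.forall_fin_one]; exact hp)
  simp only [e] at this
  exact this h0 (fun x ⟨y, hy⟩ => hs x y hy) x

theorem Pr.induction {p : M.Num → Prop} (hp : M.Pr p) (h0 : p 0) (hs : ∀ x, p x → p (x + 1))
    (x : M.Num) : p x :=
  (sigmaInduction (β := M.Num) (p := fun x _ => p x) (hp.comp Fn.fst) ⟨0, h0⟩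
    (fun x _ h => ⟨0, hs x h⟩) x).choose_spec

/-- The least number principle. -/
theorem Pr.exists_least {p : M.Num → Prop} (hp : M.Pr p) (h : ∃ x, p x) :
    ∃ x, p x ∧ ∀ y, y < x → ¬ p y := by
  by_contra! hc
  obtain ⟨x, hx⟩ := h
  have key : ∀ z, ∀ y, y < z → ¬ p y :=
    Pr.induction (Pr.ball Fn.id (hp.comp Fn.snd).not) (fun y hy => absurd hy not_lt_zero)
      fun z hz y hy hpy => by
        obtain ⟨w, hw, hpw⟩ := hc y hpy
        exact hz w (hw.trans_le (lt_add_one_iff.1 hy)) hpw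
  exact key (x + 1) x (lt_add_one_iff.2 le_rfl) hx

/-- Search: a total relation contains a function of the model. -/
theorem Pr.exists_fn {p : α → M.Num → Prop} (hp : M.Pr fun q : α × M.Num => p q.1 q.2)
    (h : ∀ a, ∃ y, p a y) :
    ∃ f : α → M.Num, M.Fn f ∧ ∀ a, p a (f a) := by
  -- Choosing the least witness makes the graph definable with a bounded quantifier.
  have (a : α) : ∃ x, p a x ∧ ∀ y, y < x → ¬ p a y :=
    Pr.exists_least (hp.comp ((Fn.const a).prodMk Fn.id)) (h a)
  choose f hf hf' using this
  refine ⟨f, Fn.of_graph (p := fun a x => p a x ∧ ∀ y, y < x → ¬ p a y)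
    (hp.and (Pr.ball Fn.snd (hp.comp (Fn.fst.fst'.prodMk Fn.snd)).not)) fun a b => ?_, hf⟩
  constructor
  · rintro rfl
    exact ⟨hf a, hf' a⟩
  · rintro ⟨h1, h2⟩
    rcases lt_trichotomy (f a) b with h | h | h
    · exact absurd (hf a) (h2 _ h)
    · exact h
    · exact absurd h1 (hf' a _ h)

/-- A function of the model is bounded on each initial segment. -/
theorem Fn.exists_bound {f : M.Num → M.Num} (hf : M.Fn f) (n : M.Num) :
    ∃ b, ∀ x, x < n → f x ≤ b :=
  sigmaInduction (p := fun n b => ∀ x, x < n → f x ≤ b)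
    (Pr.ball Fn.fst (Pr.le (hf.comp Fn.snd) Fn.fst.snd')) ⟨0, fun x hx => absurd hx not_lt_zero⟩
    (fun n b h => ⟨b + f n, fun x hx => by
      rcases (lt_add_one_iff.1 hx).lt_or_eq with h' | rfl
      · exact (h x h').trans le_self_add
      · exact le_add_self⟩) n

end Computability

section Exponentiation

variable {M : L2Structure.{u}} [Fact M.ModelsRCA₀] {α : Type u} [Coded M α]

/-! ### Codes of finite sets -/

theorem le_mul_of_ne_zero_left {a b : M.Num} (h : a ≠ 0) : b ≤ a * b :=
  le_mul_of_one_le_left zero_le (Order.one_le_iff_pos.2 (pos_iff_ne_zero.2 h))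

theorem Pr.dvd {f g : α → M.Num} (hf : M.Fn f) (hg : M.Fn g) : M.Pr fun a => f a ∣ g a := by
  refine (Pr.bex_le (p := fun a k => g a = f a * k) hg
    (Pr.eq (hg.comp Fn.fst) ((hf.comp Fn.fst).mul Fn.snd))).of_iff fun a => ⟨?_, ?_⟩
  · rintro ⟨k, hk⟩
    rcases eq_or_ne (g a) 0 with h | h
    · exact ⟨0, zero_le, by rw [h, mul_zero]⟩
    · refine ⟨k, ?_, hk⟩
      rw [hk]
      exact le_mul_of_ne_zero_left (left_ne_zero_of_mul (hk ▸ h))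
  · rintro ⟨k, -, hk⟩
    exact ⟨k, hk⟩

theorem dvd_of_dvd_add {p a b : M.Num} (h : p ∣ a + b) (ha : p ∣ a) : p ∣ b := by
  obtain ⟨u, rfl⟩ := ha
  obtain ⟨v, hv⟩ := h
  rcases le_total u v with h | h
  · obtain ⟨w, rfl⟩ := le_iff_exists_add.1 h
    rw [mul_add, add_right_inj] at hv
    exact ⟨w, hv⟩
  · have h2 : b = 0 := by
      have h3 : p * u + b ≤ p * u + 0 := by rw [add_zero]; exact hv.le.trans (mul_le_mul' le_rfl h)
      simpa using h3
    rw [h2]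
    exact dvd_zero _

/-- The moduli used to code finite sets. -/
def modulus (d i : M.Num) : M.Num := (i + 1) * d + 1

/-- Modulo `(i + 1) * d + 1` the number `(i + 1) * d` is `-1` and may be cancelled. As `e` divides
`d`, the product `e * d` divides `d * d` and may be cancelled too. -/
theorem dvd_of_modulus_dvd {c d e i k : M.Num} (hd : d = e * k)
    (h : modulus d i ∣ c * (e * d)) : modulus d i ∣ c := by
  have h1 : modulus d i ∣ c * ((i + 1) * d) * ((i + 1) * d) := by
    have : c * ((i + 1) * d) * ((i + 1) * d) = c * (e * d) * (k * (i + 1) * (i + 1)) := by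
      calc _ = c * d * (i + 1) * (i + 1) * d := by ring
        _ = c * d * (i + 1) * (i + 1) * (e * k) := by rw [← hd]
        _ = _ := by ring
    rw [this]
    exact Dvd.dvd.mul_right h _
  have step {a : M.Num} (h : modulus d i ∣ a * ((i + 1) * d)) : modulus d i ∣ a :=
    dvd_of_dvd_add (a := a * ((i + 1) * d)) ⟨a, by rw [modulus]; ring⟩ h
  exact step (step h1)

/-- Two distinct moduli differ by `(e + 1) * d` with `e < N`, where `e + 1` divides `d`. Coprimality
is stated as a cancellation law, which is the form used to build codes. -/
theorem modulus_coprime {N c d i j : M.Num} (hd : ∀ e, e < N → e + 1 ∣ d) (hi : i < N) (hj : j < N)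
    (hij : i ≠ j) (h : modulus d i ∣ c * modulus d j) : modulus d i ∣ c := by
  rcases lt_or_gt_of_ne hij with h' | h'
  · obtain ⟨e, rfl⟩ := lt_iff_exists_add_succ.1 h'
    obtain ⟨k, hk⟩ := hd e ((le_add_self.trans le_self_add).trans_lt hj)
    refine dvd_of_modulus_dvd hk (dvd_of_dvd_add (a := c * modulus d i) ?_ (dvd_mul_left _ _))
    convert h using 1
    simp only [modulus]
    ring
  · obtain ⟨e, rfl⟩ := lt_iff_exists_add_succ.1 h'
    obtain ⟨k, hk⟩ := hd e ((le_add_self.trans le_self_add).trans_lt hi)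
    refine dvd_of_modulus_dvd hk (dvd_of_dvd_add (a := c * modulus d j) ?_ h)
    refine ⟨c, ?_⟩
    simp only [modulus]
    ring

theorem exists_common_multiple (n : M.Num) : ∃ d : M.Num, d ≠ 0 ∧ ∀ i, i < n → i + 1 ∣ d := by
  refine sigmaInduction (p := fun n d => d ≠ 0 ∧ ∀ i, i < n → i + 1 ∣ d) ?_ ?_ ?_ n
  · exact (Pr.eq Fn.snd (Fn.const 0)).not.and (Pr.ball Fn.fst
      (Pr.dvd (Fn.snd.add (Fn.const 1)) Fn.fst.snd'))
  · exact ⟨1, one_ne_zero, fun i hi => absurd hi not_lt_zero⟩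
  · rintro x d ⟨h0, h⟩
    refine ⟨d * (x + 1), mul_ne_zero h0 (modelsRCA₀.basic.succ_ne_zero _), fun i hi => ?_⟩
    rcases (lt_add_one_iff.1 hi).lt_or_eq with h' | rfl
    · exact Dvd.dvd.mul_right (h i h') _
    · exact dvd_mul_left _ _

/-- Every decidable predicate is coded by two numbers, below any given bound. -/
theorem Pr.exists_code {p : M.Num → Prop} (hp : M.Pr p) (N : M.Num) :
    ∃ c d : M.Num, ∀ i, i < N → (modulus d i ∣ c ↔ p i) := by
  obtain ⟨d, hd0, hd⟩ := exists_common_multiple N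
  -- Since `d ≠ 0` every modulus exceeds `1`, so `1` codes the empty set.
  have hunit (i : M.Num) : ¬ modulus d i ∣ 1 := by
    rintro ⟨k, hk⟩
    have h1 : modulus d i ≤ 1 := by
      rw [hk, mul_comm]
      exact le_mul_of_ne_zero_left (right_ne_zero_of_mul (hk ▸ one_ne_zero))
    have h2 : (i + 1) * d + 1 ≤ 0 + 1 := by rwa [zero_add]
    simp only [add_le_add_iff_right, nonpos_iff_eq_zero, mul_eq_zero] at h2
    exact h2.elim (modelsRCA₀.basic.succ_ne_zero _) hd0
  -- The code is the product of the moduli of the members, multiplied in one at a time; coprimality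
  -- leaves the other memberships unchanged.
  have key : ∀ n, ∃ c, ∀ i, i < N → (modulus d i ∣ c ↔ i < n ∧ p i) := by
    refine sigmaInduction (p := fun n c => ∀ i, i < N → (modulus d i ∣ c ↔ i < n ∧ p i)) ?_ ?_ ?_
    · exact Pr.ball (Fn.const N) ((Pr.dvd (((Fn.snd.add (Fn.const 1)).mul (Fn.const d)).add
        (Fn.const 1)) Fn.fst.snd').iff ((Pr.lt Fn.snd Fn.fst.fst').and (hp.comp Fn.snd)))
    · exact ⟨1, fun i _ => iff_of_false (hunit i) (by simp)⟩
    · intro n c h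
      by_cases hn : n < N ∧ p n
      · refine ⟨c * modulus d n, fun i hi => ?_⟩
        rcases eq_or_ne i n with rfl | hin
        · exact iff_of_true (dvd_mul_left _ _) ⟨lt_add_one_iff.2 le_rfl, hn.2⟩
        · rw [lt_add_one_iff, le_iff_lt_or_eq, or_iff_left hin, ← h i hi]
          exact ⟨modulus_coprime hd hi hn.1 hin, fun h => Dvd.dvd.mul_right h _⟩
      · refine ⟨c, fun i hi => ?_⟩
        rw [h i hi, lt_add_one_iff, le_iff_lt_or_eq]
        refine ⟨fun h => ⟨Or.inl h.1, h.2⟩, ?_⟩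
        rintro ⟨h' | rfl, hp'⟩
        · exact ⟨h', hp'⟩
        · exact absurd ⟨hi, hp'⟩ hn
  obtain ⟨c, hc⟩ := key N
  exact ⟨c, d, fun i hi => by rw [hc i hi, and_iff_right hi]⟩

theorem cpair_mono {x y x' y' : M.Num} (hx : x ≤ x') (hy : y ≤ y') : cpair x y ≤ cpair x' y' :=
  add_le_add (triangular_mono (add_le_add hx hy)) hx

/-! ### Exponentiation -/

/-- The set coded by `(c, d)` is part of the history, with values below `b`, of the computation of
`2 ^ x`. -/
def PowHistory (x y c d b : M.Num) : Prop :=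
  -- Each coded pair must be justified by a coded predecessor, so values are unique without assuming
  -- that the coded set is a function. All quantifiers are bounded.
  (y < b ∧ modulus d (cpair x y) ∣ c) ∧ ∀ i, i ≤ x → ∀ z, z < b → modulus d (cpair i z) ∣ c →
    (i = 0 ∧ z = 1) ∨ ∃ j, j < i ∧ ∃ w, w < b ∧
      (i = j + 1 ∧ z = (1 + 1) * w ∧ modulus d (cpair j w) ∣ c)

theorem Fn.cpair {f g : α → M.Num} (hf : M.Fn f) (hg : M.Fn g) :
    M.Fn fun a => cpair (f a) (g a) := by
  have : M.Fn fun q : M.Num × M.Num => L2Structure.cpair q.1 q.2 :=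
    Fn.of_graph (p := fun q z => z + z = (q.1 + q.2) * (q.1 + q.2 + 1) + (q.1 + q.1))
      (Pr.eq (Fn.snd.add Fn.snd) ((((Fn.fst.fst'.add Fn.fst.snd').mul
        ((Fn.fst.fst'.add Fn.fst.snd').add (Fn.const 1)))).add (Fn.fst.fst'.add Fn.fst.fst')))
      fun q z => eq_comm.trans cpair_eq_iff
  exact this.comp (hf.prodMk hg)

theorem Fn.modulus {f g : α → M.Num} (hf : M.Fn f) (hg : M.Fn g) :
    M.Fn fun a => modulus (f a) (g a) :=
  ((hg.add (.const 1)).mul hf).add (.const 1)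

theorem pr_powHistory : M.Pr fun q : M.Num × (M.Num × M.Num × M.Num × M.Num) =>
    PowHistory q.1 q.2.1 q.2.2.1 q.2.2.2.1 q.2.2.2.2 := by
  unfold PowHistory
  repeat' first
    | with_reducible exact Fn.id
    | with_reducible exact Fn.const _
    | with_reducible apply Pr.and
    | with_reducible apply Pr.or
    | with_reducible apply Pr.ball_le
    | with_reducible apply Pr.ball
    | with_reducible apply Pr.bex
    | with_reducible apply Pr.dvd
    | with_reducible apply Pr.eq
    | with_reducible apply Pr.lt
    | with_reducible apply Pr.imp
    | with_reducible apply Fn.modulus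
    | with_reducible apply Fn.cpair
    | with_reducible apply Fn.fst'
    | with_reducible apply Fn.snd'
    | with_reducible apply Fn.add
    | with_reducible apply Fn.mul

theorem PowHistory.unique {x y c d b y' c' d' b' : M.Num} (h : PowHistory x y c d b)
    (h' : PowHistory x y' c' d' b') : y = y' := by
  have key : ∀ i, i ≤ x → ∀ z, z < b → ∀ z', z' < b' → modulus d (cpair i z) ∣ c →
      modulus d' (cpair i z') ∣ c' → z = z' := by
    refine Pr.induction ?_ ?_ ?_
    · repeat' first
        | with_reducible exact Fn.id
        | with_reducible exact Fn.const _
        | with_reducible apply Fn.fst'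
        | with_reducible apply Fn.snd'
        | with_reducible apply Fn.modulus
        | with_reducible apply Fn.cpair
        | with_reducible apply Pr.dvd
        | with_reducible apply Pr.eq
        | with_reducible apply Pr.le
        | with_reducible apply Pr.ball
        | with_reducible apply Pr.imp
    · intro h0 z hz z' hz' hd hd'
      rcases h.2 0 h0 z hz hd with ⟨-, rfl⟩ | ⟨j, hj, -⟩
      · rcases h'.2 0 h0 z' hz' hd' with ⟨-, rfl⟩ | ⟨j, hj, -⟩
        · rfl
        · exact absurd hj not_lt_zero
      · exact absurd hj not_lt_zero
    · intro i ih hi z hz z' hz' hd hd'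
      rcases h.2 _ hi z hz hd with ⟨h0, -⟩ | ⟨j, hj, w, hw, e, rfl, hdw⟩
      · exact absurd h0 (modelsRCA₀.basic.succ_ne_zero _)
      rcases h'.2 _ hi z' hz' hd' with ⟨h0, -⟩ | ⟨j', hj', w', hw', e', rfl, hdw'⟩
      · exact absurd h0 (modelsRCA₀.basic.succ_ne_zero _)
      obtain rfl := add_right_cancel e
      obtain rfl := add_right_cancel e'
      rw [ih (le_self_add.trans hi) w hw w' hw' hdw hdw']
  exact key x le_rfl y h.1.1 y' h'.1.1 h.1.2 h'.1.2

theorem PowHistory.succ {x y c d b : M.Num} (h : PowHistory x y c d b) :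
    ∃ c' d' b', PowHistory (x + 1) ((1 + 1) * y) c' d' b' := by
  -- The old code constrains nothing outside `i ≤ x`, `w < b`, so only entries in that range are
  -- copied before the new pair is added.
  let p : M.Num → Prop := fun z => z = cpair (x + 1) ((1 + 1) * y) ∨
    (modulus d z ∣ c ∧ ∃ i, i ≤ x ∧ ∃ w, w < b ∧ z = cpair i w)
  have hp : M.Pr p := by
    repeat' first
      | with_reducible exact Fn.id
      | with_reducible exact Fn.const _
      | with_reducible apply Fn.fst'
      | with_reducible apply Fn.snd'
      | with_reducible apply Fn.modulus
      | with_reducible apply Fn.cpair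
      | with_reducible apply Pr.dvd
      | with_reducible apply Pr.eq
      | with_reducible apply Pr.or
      | with_reducible apply Pr.and
      | with_reducible apply Pr.bex_le
      | with_reducible apply Pr.bex
  set b' := b + (1 + 1) * y + 1 with hb'
  obtain ⟨c', d', h'⟩ := hp.exists_code (cpair (x + 1) b' + 1)
  have hmem {i z : M.Num} (hi : i ≤ x + 1) (hz : z < b') :
      modulus d' (cpair i z) ∣ c' ↔ p (cpair i z) :=
    h' _ (lt_add_one_iff.2 (cpair_mono hi hz.le))
  have hbb {w : M.Num} (hw : w < b) : w < b' :=
    lt_add_one_iff.2 (hw.le.trans le_self_add)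
  have hyb : (1 + 1) * y < b' := lt_add_one_iff.2 le_add_self
  refine ⟨c', d', b', ⟨hyb, (hmem le_rfl hyb).2 (Or.inl rfl)⟩, fun i hi z hz hd => ?_⟩
  rcases (hmem hi hz).1 hd with h1 | ⟨h1, i', hi', w, hw, h2⟩
  · obtain ⟨rfl, rfl⟩ := cpair_inj h1
    refine Or.inr ⟨x, lt_add_one_iff.2 le_rfl, y, hbb h.1.1, rfl, rfl, ?_⟩
    exact (hmem le_self_add (hbb h.1.1)).2 (Or.inr ⟨h.1.2, x, le_rfl, y, h.1.1, rfl⟩)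
  · obtain ⟨rfl, rfl⟩ := cpair_inj h2
    rcases h.2 _ hi' _ hw h1 with h3 | ⟨j, hj, w, hw', rfl, rfl, h4⟩
    · exact Or.inl h3
    · have hjx : j ≤ x := hj.le.trans hi'
      exact Or.inr ⟨j, hj, w, hbb hw', rfl, rfl, (hmem (hjx.trans le_self_add) (hbb hw')).2
        (Or.inr ⟨h4, j, hjx, w, hw', rfl⟩)⟩

theorem exists_powHistory (x : M.Num) :
    ∃ q : M.Num × M.Num × M.Num × M.Num, PowHistory x q.1 q.2.1 q.2.2.1 q.2.2.2 := by
  refine sigmaInduction (p := fun x (q : M.Num × M.Num × M.Num × M.Num) =>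
    PowHistory x q.1 q.2.1 q.2.2.1 q.2.2.2) pr_powHistory ?_ ?_ x
  · obtain ⟨c, d, h⟩ := Pr.exists_code (p := fun z => z = cpair 0 1) (Pr.eq Fn.id (Fn.const _))
      (cpair 0 (1 + 1) + 1 : M.Num)
    have h1 : (1 : M.Num) < 1 + 1 := lt_add_one_iff.2 le_rfl
    have hmem {z : M.Num} (hz : z < 1 + 1) := h _ (lt_add_one_iff.2 (cpair_mono le_rfl hz.le))
    refine ⟨(1, c, d, 1 + 1), ⟨h1, (hmem h1).2 rfl⟩, fun i hi z hz hd => ?_⟩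
    obtain rfl := nonpos_iff_eq_zero.1 hi
    exact Or.inl ⟨rfl, (cpair_inj ((hmem hz).1 hd)).2⟩
  · rintro x ⟨y, c, d, b⟩ h
    obtain ⟨c', d', b', h'⟩ := PowHistory.succ h
    exact ⟨(_, c', d', b'), h'⟩

/-- The number `2 ^ x`. -/
noncomputable def exp2 (x : M.Num) : M.Num := (exists_powHistory x).choose.1

theorem exp2_eq_iff {x y : M.Num} : exp2 x = y ↔ ∃ c d b, PowHistory x y c d b := by
  have := (exists_powHistory x).choose_spec
  constructor
  · rintro rfl
    exact ⟨_, _, _, this⟩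
  · rintro ⟨c, d, b, h⟩
    exact this.unique h

theorem exp2_zero : exp2 (0 : M.Num) = 1 := by
  obtain ⟨c, d, b, h⟩ := exp2_eq_iff.1 (rfl : exp2 (0 : M.Num) = _)
  rcases h.2 0 le_rfl _ h.1.1 h.1.2 with h | ⟨j, hj, -⟩
  · exact h.2
  · exact absurd hj not_lt_zero

theorem exp2_succ (x : M.Num) : exp2 (x + 1) = (1 + 1) * exp2 x := by
  obtain ⟨c, d, b, h⟩ := exp2_eq_iff.1 (rfl : exp2 x = _)
  exact exp2_eq_iff.2 h.succ

/-- Histories exist and determine their value, so the graph is `Σ⁰₁` by "some history gives `y`" and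
`Π⁰₁` by "every history gives `y`". -/
theorem Fn.exp2 {f : α → M.Num} (hf : M.Fn f) : M.Fn fun a => exp2 (f a) := by
  have h : M.Fn (L2Structure.exp2 : M.Num → M.Num) := by
    refine Pr.of_exists_forall (β := M.Num × M.Num × M.Num × M.Num)
      (q := fun q => q.1.2 = q.2.1 ∧ PowHistory q.1.1 q.2.1 q.2.2.1 q.2.2.2.1 q.2.2.2.2)
      (r := fun q => PowHistory q.1.1 q.2.1 q.2.2.1 q.2.2.2.1 q.2.2.2.2 → q.1.2 = q.2.1)
      ((Pr.eq Fn.fst.snd' Fn.snd.fst').and (pr_powHistory.comp (Fn.fst.fst'.prodMk Fn.snd)))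
      (Pr.imp (pr_powHistory.comp (Fn.fst.fst'.prodMk Fn.snd)) (Pr.eq Fn.fst.snd' Fn.snd.fst'))
      ?_ ?_
    · rintro ⟨x, y⟩
      refine exp2_eq_iff.trans ⟨fun ⟨c, d, b, h⟩ => ⟨(y, c, d, b), rfl, h⟩, ?_⟩
      rintro ⟨⟨y', c, d, b⟩, h', h⟩
      obtain rfl : y = y' := h'
      exact ⟨c, d, b, h⟩
    · rintro ⟨x, y⟩
      constructor
      · rintro h' ⟨y', c, d, b⟩ h
        exact h'.symm.trans (exp2_eq_iff.2 ⟨c, d, b, h⟩)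
      · intro h
        obtain ⟨c, d, b, h'⟩ := exp2_eq_iff.1 (rfl : L2Structure.exp2 x = _)
        exact (h (_, c, d, b) h').symm
  exact h.comp hf

end Exponentiation

section Strings

variable {M : L2Structure.{u}} [Fact M.ModelsRCA₀] {α : Type u} [Coded M α]

/-! ### Powers of two -/

theorem exp2_ne_zero (x : M.Num) : exp2 x ≠ 0 := by
  refine Pr.induction (p := fun x => exp2 x ≠ 0) (Pr.eq (Fn.exp2 Fn.id) (Fn.const 0)).not ?_ ?_ x
  · rw [exp2_zero]
    exact one_ne_zero
  · intro x hx
    rw [exp2_succ]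
    exact mul_ne_zero (modelsRCA₀.basic.succ_ne_zero 1) hx

theorem exp2_pos (x : M.Num) : 0 < exp2 x := pos_iff_ne_zero.2 (exp2_ne_zero x)

theorem exp2_add (x y : M.Num) : exp2 (x + y) = exp2 x * exp2 y := by
  refine Pr.induction (p := fun y => exp2 (x + y) = exp2 x * exp2 y) ?_ ?_ ?_ y
  · exact Pr.eq (Fn.exp2 ((Fn.const x).add Fn.id)) ((Fn.const _).mul (Fn.exp2 Fn.id))
  · rw [add_zero, exp2_zero, mul_one]
  · intro y hy
    rw [← add_assoc, exp2_succ, hy, exp2_succ, mul_left_comm]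

theorem exp2_mono {x y : M.Num} (h : x ≤ y) : exp2 x ≤ exp2 y := by
  obtain ⟨z, rfl⟩ := le_iff_exists_add.1 h
  rw [exp2_add, mul_comm]
  exact le_mul_of_ne_zero_left (exp2_ne_zero z)

theorem lt_exp2 (x : M.Num) : x < exp2 x := by
  refine Pr.induction (p := fun x => x < exp2 x) (Pr.lt Fn.id (Fn.exp2 Fn.id)) (exp2_pos _) ?_ x
  intro x hx
  rw [exp2_succ, add_mul, one_mul]
  exact add_lt_add_of_lt_of_le hx (Order.one_le_iff_pos.2 (exp2_pos x))

/-! ### The pairing and the powers of two of the statement. -/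

theorem pair_inj {x y x' y' : M.Num} (h : M.pair x y = M.pair x' y') : x = x' ∧ y = y' := by
  -- With `s = x + y`, the code lies between `s * s` and `(s + 1) * (s + 1)`, strictly below the
  -- latter.
  have key : ∀ {x y x' y' : M.Num}, x + y < x' + y' → M.pair x y < M.pair x' y' := by
    intro x y x' y' h
    calc M.pair x y ≤ (x + y) * (x + y) + (x + y) := add_le_add_right le_self_add _
      _ < (x + y) * (x + y) + (x + y) + (x + y) + 1 := lt_add_one_iff.2 le_self_add
      _ = (x + y + 1) * (x + y + 1) := by ring
      _ ≤ (x' + y') * (x' + y') :=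
        mul_le_mul' (Order.add_one_le_iff.2 h) (Order.add_one_le_iff.2 h)
      _ ≤ M.pair x' y' := le_self_add
  rcases lt_trichotomy (x + y) (x' + y') with h' | h' | h'
  · exact absurd h (key h').ne
  · rw [pair, pair, h', add_right_inj] at h
    subst h
    exact ⟨rfl, add_left_cancel h'⟩
  · exact absurd h (key h').ne'

theorem le_mul_self (x : M.Num) : x ≤ x * x := by
  rcases eq_or_ne x 0 with rfl | h
  · exact zero_le
  · exact le_mul_of_ne_zero_left h

theorem Fn.pair {f g : α → M.Num} (hf : M.Fn f) (hg : M.Fn g) :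
    M.Fn fun a => M.pair (f a) (g a) :=
  ((hf.add hg).mul (hf.add hg)).add hf

/-- A binary relation as a set of pairs. -/
def pairSet (p : M.Num → M.Num → Prop) : Set M.Num := {z | ∃ x y, z = M.pair x y ∧ p x y}

theorem pair_mem_pairSet {p : M.Num → M.Num → Prop} {x y : M.Num} :
    M.pair x y ∈ pairSet p ↔ p x y := by
  constructor
  · rintro ⟨x', y', h, h'⟩
    obtain ⟨rfl, rfl⟩ := pair_inj h
    exact h'
  · exact fun h => ⟨x, y, rfl, h⟩

theorem pairSet_mem_sets {p : M.Num → M.Num → Prop}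
    (hp : M.Pr fun q : M.Num × M.Num => p q.1 q.2) : pairSet p ∈ M.sets := by
  have : M.Pr fun z : M.Num => ∃ x, x ≤ z ∧ ∃ y, y ≤ z ∧ (z = M.pair x y ∧ p x y) :=
    Pr.bex_le Fn.id (Pr.bex_le Fn.fst ((Pr.eq Fn.fst.fst' (Fn.pair Fn.fst.snd' Fn.snd)).and
      (hp.comp (Fn.fst.snd'.prodMk Fn.snd))))
  refine this.of_iff (q := fun z => z ∈ pairSet p) fun z => ⟨?_, ?_⟩
  · rintro ⟨x, y, rfl, h⟩
    exact ⟨x, le_add_self, y, (le_add_self.trans (le_mul_self (x + y))).trans le_self_add, rfl, h⟩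
  · rintro ⟨x, -, y, -, h⟩
    exact ⟨x, y, h⟩

/-- The defining set of `PowTwo` must contain the graph of `exp2`, by induction along it; conversely
that graph is a set of the model. -/
theorem powTwo_iff {x y : M.Num} : M.PowTwo x y ↔ exp2 x = y := by
  constructor
  · rintro ⟨g, hg, hfun, h0, hs, hxy⟩
    have : M.pair x (exp2 x) ∈ g := by
      refine Pr.induction (p := fun x => M.pair x (exp2 x) ∈ g)
        (Pr.mem hg (Fn.pair Fn.id (Fn.exp2 Fn.id))) ?_ ?_ x
      · rwa [exp2_zero]
      · intro i hi
        rw [exp2_succ]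
        exact hs _ _ hi
    exact (hfun.2 x).unique this hxy
  · rintro rfl
    refine ⟨pairSet fun x y => exp2 x = y, pairSet_mem_sets (Pr.eq (Fn.exp2 Fn.fst) Fn.snd),
      ⟨fun z ⟨x, y, h, _⟩ => ⟨x, y, h⟩, fun x => ⟨exp2 x, pair_mem_pairSet.2 rfl, fun y hy =>
        (pair_mem_pairSet.1 hy).symm⟩⟩, pair_mem_pairSet.2 exp2_zero, fun i a h => ?_,
      pair_mem_pairSet.2 rfl⟩
    rw [pair_mem_pairSet] at h ⊢
    rw [exp2_succ, h]

/-! ### Division -/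

theorem exists_div {y : M.Num} (hy : y ≠ 0) (x : M.Num) : ∃ q r, r < y ∧ x = q * y + r := by
  obtain ⟨⟨q, r⟩, h⟩ := sigmaInduction (p := fun x (q : M.Num × M.Num) =>
    q.2 < y ∧ x = q.1 * y + q.2)
    ((Pr.lt Fn.snd.snd' (Fn.const y)).and (Pr.eq Fn.fst
      ((Fn.snd.fst'.mul (Fn.const y)).add Fn.snd.snd')))
    ⟨(0, 0), pos_iff_ne_zero.2 hy, by simp⟩
    (by
      rintro x ⟨q, r⟩ ⟨hr, rfl⟩
      rcases (Order.add_one_le_iff.2 hr).lt_or_eq with h | h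
      · exact ⟨(q, r + 1), h, add_assoc _ _ _⟩
      · refine ⟨(q + 1, 0), pos_iff_ne_zero.2 hy, ?_⟩
        simp only at h
        rw [add_assoc, h]
        ring) x
  exact ⟨q, r, h⟩

theorem div_unique {y q r q' r' : M.Num} (hr : r < y) (hr' : r' < y)
    (h : q * y + r = q' * y + r') : q = q' ∧ r = r' := by
  have key : ∀ {q r q' r' : M.Num}, r < y → q < q' → q * y + r < q' * y + r' := by
    intro q r q' r' hr hq
    calc q * y + r < q * y + y := by gcongr
      _ = (q + 1) * y := by ring
      _ ≤ q' * y := mul_le_mul' (Order.add_one_le_iff.2 hq) le_rfl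
      _ ≤ q' * y + r' := le_self_add
  rcases lt_trichotomy q q' with hq | rfl | hq
  · exact absurd h (key hr hq).ne
  · exact ⟨rfl, add_left_cancel h⟩
  · exact absurd h (key hr' hq).ne'

/-! ### Length -/

theorem hasLength_iff {σ l : M.Num} :
    M.HasLength σ l ↔ exp2 l ≤ σ ∧ σ < (1 + 1) * exp2 l := by
  constructor
  · rintro ⟨p, hp, h⟩
    rw [← powTwo_iff.1 hp] at h
    exact h
  · intro h
    exact ⟨_, powTwo_iff.2 rfl, h⟩

theorem exists_hasLength {σ : M.Num} (hσ : σ ≠ 0) : ∃ l, M.HasLength σ l := by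
  simp_rw [hasLength_iff]
  obtain ⟨l, hl, hl'⟩ := Pr.exists_least (p := fun l => σ < (1 + 1) * exp2 l)
    (Pr.lt (Fn.const σ) ((Fn.const _).mul (Fn.exp2 Fn.id)))
    ⟨σ, (lt_exp2 σ).trans_le (le_mul_of_ne_zero_left (modelsRCA₀.basic.succ_ne_zero 1))⟩
  refine ⟨l, ?_, hl⟩
  rcases modelsRCA₀.eq_zero_or_succ l with rfl | ⟨l, rfl⟩
  · rw [exp2_zero]
    exact Order.one_le_iff_pos.2 (pos_iff_ne_zero.2 hσ)
  · rw [exp2_succ]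
    exact not_lt.1 (hl' l (lt_add_one_iff.2 le_rfl))

theorem HasLength.unique {σ l l' : M.Num} (h : M.HasLength σ l) (h' : M.HasLength σ l') :
    l = l' := by
  have key : ∀ {l l'}, M.HasLength σ l → M.HasLength σ l' → ¬ l < l' := by
    intro l l' h h' hl
    rw [hasLength_iff] at h h'
    rw [← exp2_succ] at h
    exact absurd (h.2.trans_le (exp2_mono (Order.add_one_le_iff.2 hl))) (not_lt.2 h'.1)
  exact le_antisymm (not_lt.1 (key h' h)) (not_lt.1 (key h h'))

open Classical in
/-- The length of a string. -/
noncomputable def len (σ : M.Num) : M.Num :=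
  -- Zero codes no string. With default length `0`, the hypothesis `i < len σ` already excludes it.
  if h : σ ≠ 0 then (exists_hasLength h).choose else 0

theorem hasLength_len {σ : M.Num} (hσ : σ ≠ 0) : M.HasLength σ (len σ) := by
  rw [len, dif_pos hσ]
  exact (exists_hasLength hσ).choose_spec

theorem HasLength.ne_zero {σ l : M.Num} (h : M.HasLength σ l) : σ ≠ 0 := by
  rw [hasLength_iff] at h
  exact pos_iff_ne_zero.1 ((exp2_pos l).trans_le h.1)

theorem hasLength_iff_len {σ l : M.Num} : M.HasLength σ l ↔ σ ≠ 0 ∧ len σ = l := by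
  constructor
  · intro h
    exact ⟨h.ne_zero, (hasLength_len h.ne_zero).unique h⟩
  · rintro ⟨h, rfl⟩
    exact hasLength_len h

theorem Fn.len {f : α → M.Num} (hf : M.Fn f) : M.Fn fun a => len (f a) := by
  have : M.Fn (L2Structure.len : M.Num → M.Num) := by
    refine Fn.of_graph (p := fun σ l => (σ = 0 ∧ l = 0) ∨
      M.HasLength σ l) ?_ fun σ l => ?_
    · simp_rw [hasLength_iff]
      exact ((Pr.eq Fn.fst (Fn.const 0)).and (Pr.eq Fn.snd (Fn.const 0))).or
        ((Pr.le (Fn.exp2 Fn.snd) Fn.fst).and (Pr.lt Fn.fst ((Fn.const _).mul (Fn.exp2 Fn.snd))))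
    · rw [hasLength_iff_len]
      rcases eq_or_ne σ 0 with rfl | h
      · simp [L2Structure.len, eq_comm]
      · simp [h]
  exact this.comp hf

theorem lt_two_mul_exp2_len {σ : M.Num} (hσ : σ ≠ 0) : σ < (1 + 1) * exp2 (len σ) :=
  (hasLength_iff.1 (hasLength_len hσ)).2

theorem exp2_len_le {σ : M.Num} (hσ : σ ≠ 0) : exp2 (len σ) ≤ σ :=
  (hasLength_iff.1 (hasLength_len hσ)).1

theorem len_one : len (1 : M.Num) = 0 :=
  (hasLength_iff_len.1 (hasLength_iff.2 (by
    rw [exp2_zero, mul_one]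
    exact ⟨le_rfl, lt_add_one_iff.2 le_rfl⟩))).2

/-! ### Initial segments -/

theorem isPrefix_iff {σ τ : M.Num} :
    M.IsPrefix σ τ ↔ σ ≠ 0 ∧ ∃ j r, r < exp2 j ∧ τ = σ * exp2 j + r := by
  refine and_congr_right fun _ => exists_congr fun j => ⟨?_, ?_⟩
  · rintro ⟨p, r, hp, h⟩
    rw [← powTwo_iff.1 hp] at h
    exact ⟨r, h⟩
  · rintro ⟨r, h⟩
    exact ⟨_, r, powTwo_iff.2 rfl, h⟩

theorem len_mul_exp2_add {σ j r : M.Num} (hσ : σ ≠ 0) (hr : r < exp2 j) :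
    len (σ * exp2 j + r) = len σ + j := by
  refine (hasLength_iff_len.1 (hasLength_iff.2 ⟨?_, ?_⟩)).2
  · rw [exp2_add]
    exact (mul_le_mul' (exp2_len_le hσ) le_rfl).trans le_self_add
  · calc σ * exp2 j + r < σ * exp2 j + exp2 j := by gcongr
      _ = (σ + 1) * exp2 j := by ring
      _ ≤ (1 + 1) * exp2 (len σ) * exp2 j :=
        mul_le_mul' (Order.add_one_le_iff.2 (lt_two_mul_exp2_len hσ)) le_rfl
      _ = _ := by rw [exp2_add, mul_assoc]

theorem IsPrefix.ne_zero_right {σ τ : M.Num} (h : M.IsPrefix σ τ) : τ ≠ 0 := by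
  obtain ⟨h0, j, r, hr, rfl⟩ := isPrefix_iff.1 h
  simp [h0, exp2_ne_zero]

theorem IsPrefix.len_le {σ τ : M.Num} (h : M.IsPrefix σ τ) : len σ ≤ len τ := by
  obtain ⟨h0, j, r, hr, rfl⟩ := isPrefix_iff.1 h
  rw [len_mul_exp2_add h0 hr]
  exact le_self_add

theorem IsPrefix.refl {σ : M.Num} (h : σ ≠ 0) : M.IsPrefix σ σ :=
  isPrefix_iff.2 ⟨h, 0, 0, exp2_pos 0, by rw [exp2_zero, mul_one, add_zero]⟩

theorem IsPrefix.trans {ρ σ τ : M.Num} (h : M.IsPrefix ρ σ) (h' : M.IsPrefix σ τ) :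
    M.IsPrefix ρ τ := by
  obtain ⟨h0, j, r, hr, rfl⟩ := isPrefix_iff.1 h
  obtain ⟨-, j', r', hr', rfl⟩ := isPrefix_iff.1 h'
  refine isPrefix_iff.2 ⟨h0, j + j', r * exp2 j' + r', ?_, ?_⟩
  · calc r * exp2 j' + r' < r * exp2 j' + exp2 j' := by gcongr
      _ = (r + 1) * exp2 j' := by ring
      _ ≤ exp2 j * exp2 j' := mul_le_mul' (Order.add_one_le_iff.2 hr) le_rfl
      _ = _ := (exp2_add _ _).symm
  · rw [exp2_add]
    ring

theorem IsPrefix.unique {ρ ρ' τ : M.Num} (h : M.IsPrefix ρ τ) (h' : M.IsPrefix ρ' τ)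
    (hl : len ρ = len ρ') : ρ = ρ' := by
  obtain ⟨h0, j, r, hr, e⟩ := isPrefix_iff.1 h
  obtain ⟨h0', j', r', hr', e'⟩ := isPrefix_iff.1 h'
  have h1 : len ρ + j = len ρ' + j' := by
    rw [← len_mul_exp2_add h0 hr, ← len_mul_exp2_add h0' hr', ← e, ← e']
  rw [hl, add_right_inj] at h1
  subst h1
  exact (div_unique hr hr' (e.symm.trans e')).1

theorem IsPrefix.eq_of_len_eq {σ τ : M.Num} (h : M.IsPrefix σ τ) (hl : len σ = len τ) : σ = τ :=
  h.unique (.refl h.ne_zero_right) hl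

theorem exists_prefix {τ i : M.Num} (hτ : τ ≠ 0) (hi : i ≤ len τ) :
    ∃ ρ, M.IsPrefix ρ τ ∧ len ρ = i := by
  obtain ⟨j, hj⟩ := le_iff_exists_add.1 hi
  obtain ⟨q, r, hr, rfl⟩ := exists_div (exp2_ne_zero j) τ
  have hq : q ≠ 0 := by
    rintro rfl
    have h1 := exp2_len_le hτ
    rw [hj] at h1
    have h2 : exp2 j ≤ exp2 (i + j) := exp2_mono le_add_self
    rw [zero_mul, zero_add] at h1
    exact absurd hr (not_lt.2 (h2.trans h1))
  rw [len_mul_exp2_add hq hr, add_left_inj] at hj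
  exact ⟨q, isPrefix_iff.2 ⟨hq, j, r, hr, rfl⟩, hj⟩

theorem IsPrefix.of_len_le {ρ ρ' τ : M.Num} (h : M.IsPrefix ρ τ) (h' : M.IsPrefix ρ' τ)
    (hl : len ρ ≤ len ρ') : M.IsPrefix ρ ρ' := by
  obtain ⟨ρ'', h1, h2⟩ := exists_prefix h'.1 hl
  rwa [h.unique (h1.trans h') h2.symm]

theorem Pr.isPrefix {f g : α → M.Num} (hf : M.Fn f) (hg : M.Fn g) :
    M.Pr fun a => M.IsPrefix (f a) (g a) := by
  have : M.Pr fun q : M.Num × M.Num => q.1 ≠ 0 ∧ ∃ j, j ≤ q.2 ∧ ∃ r, r < exp2 j ∧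
      q.2 = q.1 * exp2 j + r :=
    (Pr.eq Fn.fst (Fn.const 0)).not.and (Pr.bex_le Fn.snd (Pr.bex (Fn.exp2 Fn.snd)
      (Pr.eq Fn.fst.fst'.snd' ((Fn.fst.fst'.fst'.mul (Fn.exp2 Fn.fst.snd')).add Fn.snd))))
  have : M.Pr fun q : M.Num × M.Num => M.IsPrefix q.1 q.2 := by
    refine this.of_iff fun q => ?_
    rw [isPrefix_iff]
    refine and_congr_right fun h0 => exists_congr fun j => ⟨?_, And.right⟩
    rintro ⟨r, hr, h⟩
    refine ⟨?_, r, hr, h⟩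
    rw [h]
    exact ((lt_exp2 j).le.trans (le_mul_of_ne_zero_left h0)).trans le_self_add
  exact this.comp (hf.prodMk hg)

/-! ### Bits -/

theorem isPrefix_appendZero {σ : M.Num} (h : σ ≠ 0) : M.IsPrefix σ (M.appendZero σ) :=
  isPrefix_iff.2 ⟨h, 0 + 1, 0, exp2_pos _, by rw [exp2_succ, exp2_zero, appendZero]; ring⟩

theorem isPrefix_appendOne {σ : M.Num} (h : σ ≠ 0) : M.IsPrefix σ (M.appendOne σ) :=
  isPrefix_iff.2 ⟨h, 0 + 1, 1, by
    rw [exp2_succ, exp2_zero, mul_one]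
    exact lt_add_one_iff.2 le_rfl, by rw [exp2_succ, exp2_zero, appendOne]; ring⟩

theorem zero_lt_exp2_one : (0 : M.Num) < exp2 1 := exp2_pos _

theorem exp2_one : exp2 (1 : M.Num) = 1 + 1 := by
  rw [← zero_add (1 : M.Num), exp2_succ, exp2_zero, mul_one, zero_add]

theorem len_appendZero {σ : M.Num} (h : σ ≠ 0) : len (M.appendZero σ) = len σ + 1 := by
  rw [← len_mul_exp2_add h zero_lt_exp2_one, exp2_one, appendZero, add_zero, mul_comm]

theorem len_appendOne {σ : M.Num} (h : σ ≠ 0) : len (M.appendOne σ) = len σ + 1 := by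
  have : (1 : M.Num) < exp2 1 := by
    rw [exp2_one]
    exact lt_add_one_iff.2 le_rfl
  rw [← len_mul_exp2_add h this, exp2_one, appendOne, mul_comm]

theorem appendZero_ne_appendOne (σ τ : M.Num) : M.appendZero σ ≠ M.appendOne τ := by
  intro h
  have h1 : (1 : M.Num) < 1 + 1 := lt_add_one_iff.2 le_rfl
  refine zero_ne_one (div_unique (y := 1 + 1) (q := σ) (q' := τ) (zero_lt_one.trans h1) h1 ?_).2
  rw [add_zero, mul_comm, mul_comm τ]
  exact h

theorem eq_append {σ : M.Num} (h : len σ ≠ 0) :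
    ∃ ρ, ρ ≠ 0 ∧ (σ = M.appendZero ρ ∨ σ = M.appendOne ρ) := by
  have hσ : σ ≠ 0 := by
    rintro rfl
    exact h (by simp [len])
  obtain ⟨l, hl⟩ := (modelsRCA₀.eq_zero_or_succ (len σ)).resolve_left h
  obtain ⟨ρ, h1, h2⟩ := exists_prefix (i := l) hσ (hl ▸ le_self_add)
  obtain ⟨h0, j, r, hr, rfl⟩ := isPrefix_iff.1 h1
  rw [len_mul_exp2_add h0 hr, h2, add_right_inj] at hl
  subst hl
  rw [exp2_one] at hr ⊢
  refine ⟨ρ, h0, (lt_add_one_iff.1 hr).lt_or_eq.imp (fun h => ?_) (fun h => ?_)⟩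
  · rw [Order.lt_one_iff.1 h, add_zero, appendZero, mul_comm]
  · rw [h, appendOne, mul_comm]

/-- The bit in position `i` of the string `σ` is `1`. -/
def Bit (σ i : M.Num) : Prop := ∃ ρ, ρ ≠ 0 ∧ len ρ = i ∧ M.IsPrefix (M.appendOne ρ) σ

theorem Pr.bit {f g : α → M.Num} (hf : M.Fn f) (hg : M.Fn g) :
    M.Pr fun a => Bit (f a) (g a) := by
  refine (Pr.bex_le (p := fun a ρ => ρ ≠ 0 ∧ len ρ = g a ∧ M.IsPrefix (M.appendOne ρ) (f a)) hf
    ((Pr.eq Fn.snd (Fn.const 0)).not.and ((Pr.eq (Fn.len Fn.snd) (hg.comp Fn.fst)).and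
      (Pr.isPrefix (((Fn.const _).mul Fn.snd).add (Fn.const 1)) (hf.comp Fn.fst))))).of_iff
      fun a => ⟨?_, fun ⟨ρ, _, h⟩ => ⟨ρ, h⟩⟩
  rintro ⟨ρ, h0, h1, h2⟩
  refine ⟨ρ, ?_, h0, h1, h2⟩
  obtain ⟨-, j, r, -, h⟩ := isPrefix_iff.1 ((isPrefix_appendOne h0).trans h2)
  rw [h, mul_comm]
  exact (le_mul_of_ne_zero_left (exp2_ne_zero j)).trans le_self_add

theorem Bit.lt_len {σ i : M.Num} (h : Bit σ i) : i < len σ := by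
  obtain ⟨ρ, h0, rfl, h⟩ := h
  rw [← Order.add_one_le_iff, ← len_appendOne h0]
  exact h.len_le

theorem not_bit_of_appendZero {σ ρ : M.Num} (h0 : ρ ≠ 0) (h : M.IsPrefix (M.appendZero ρ) σ) :
    ¬ Bit σ (len ρ) := by
  rintro ⟨ρ', h0', hl, h'⟩
  exact appendZero_ne_appendOne _ _ (h.unique h' (by
    rw [len_appendZero h0, len_appendOne h0', hl]))

theorem exists_append_prefix {σ i : M.Num} (hi : i < len σ) :
    ∃ ρ, ρ ≠ 0 ∧ len ρ = i ∧ (Bit σ i → M.IsPrefix (M.appendOne ρ) σ) ∧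
      (¬ Bit σ i → M.IsPrefix (M.appendZero ρ) σ) := by
  have hσ : σ ≠ 0 := by
    rintro rfl
    simp [len] at hi
  obtain ⟨ρ, h1, h2⟩ := exists_prefix hσ (Order.add_one_le_iff.2 hi)
  obtain ⟨ρ, h0, rfl | rfl⟩ := eq_append (h2 ▸ modelsRCA₀.basic.succ_ne_zero i)
  · rw [len_appendZero h0, add_left_inj] at h2
    subst h2
    exact ⟨ρ, h0, rfl, fun h => absurd h (not_bit_of_appendZero h0 h1), fun _ => h1⟩
  · rw [len_appendOne h0, add_left_inj] at h2
    subst h2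
    exact ⟨ρ, h0, rfl, fun _ => h1, fun h => absurd ⟨ρ, h0, rfl, h1⟩ h⟩

theorem IsPrefix.bit_iff {σ τ i : M.Num} (h : M.IsPrefix σ τ) (hi : i < len σ) :
    Bit σ i ↔ Bit τ i := by
  constructor
  · rintro ⟨ρ, h0, h1, h2⟩
    exact ⟨ρ, h0, h1, h2.trans h⟩
  · rintro ⟨ρ, h0, rfl, h2⟩
    refine ⟨ρ, h0, rfl, h2.of_len_le h ?_⟩
    rw [len_appendOne h0]
    exact Order.add_one_le_iff.2 hi

/-- A common prefix of length `i` is extended bit by bit; the prefix is the witness of a `Σ⁰₁`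
induction on `i`. -/
theorem string_ext {σ τ : M.Num} (hσ : σ ≠ 0) (hτ : τ ≠ 0) (hl : len σ = len τ)
    (hb : ∀ i, i < len σ → (Bit σ i ↔ Bit τ i)) : σ = τ := by
  obtain ⟨ρ, h⟩ := sigmaInduction
    (p := fun i ρ => i ≤ len σ → M.IsPrefix ρ σ ∧ M.IsPrefix ρ τ ∧ len ρ = i)
    (Pr.imp (Pr.le Fn.fst (Fn.const _)) ((Pr.isPrefix Fn.snd (Fn.const σ)).and
      ((Pr.isPrefix Fn.snd (Fn.const τ)).and (Pr.eq (Fn.len Fn.snd) Fn.fst))))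
    (by
      obtain ⟨ρ, h1, h2⟩ := exists_prefix (i := 0) hσ zero_le
      obtain ⟨ρ', h1', h2'⟩ := exists_prefix (i := 0) hτ zero_le
      have : M.IsPrefix (1 : M.Num) σ ∧ M.IsPrefix (1 : M.Num) τ := by
        have key {ρ : M.Num} (h0 : ρ ≠ 0) (h : len ρ = 0) : ρ = 1 := by
          have h3 := lt_two_mul_exp2_len h0
          rw [h, exp2_zero, mul_one, lt_add_one_iff] at h3
          exact h3.antisymm (Order.one_le_iff_pos.2 (pos_iff_ne_zero.2 h0))
        rw [key h1.1 h2] at h1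
        rw [key h1'.1 h2'] at h1'
        exact ⟨h1, h1'⟩
      exact ⟨1, fun _ => ⟨this.1, this.2, len_one⟩⟩)
    (fun i ρ h => by
      by_cases hi : i + 1 ≤ len σ
      swap
      -- Beyond the length of `σ` the claim is vacuous and any witness serves.
      · exact ⟨0, fun h => absurd h hi⟩
      obtain ⟨h1, h2, rfl⟩ := h (le_self_add.trans hi)
      have hi := Order.add_one_le_iff.1 hi
      obtain ⟨ρ1, a0, a1, a2, a3⟩ := exists_append_prefix hi
      obtain ⟨ρ2, b0, b1, b2, b3⟩ := exists_append_prefix (hi.trans_eq hl)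
      by_cases hbit : Bit σ (len ρ)
      · have a4 := a2 hbit
        have b4 := b2 ((hb _ hi).1 hbit)
        obtain rfl := ((isPrefix_appendOne a0).trans a4).unique h1 a1
        obtain rfl := ((isPrefix_appendOne b0).trans b4).unique h2 b1
        exact ⟨M.appendOne ρ2, fun _ => ⟨a4, b4, len_appendOne b0⟩⟩
      · have a4 := a3 hbit
        have b4 := b3 (fun h => hbit ((hb _ hi).2 h))
        obtain rfl := ((isPrefix_appendZero a0).trans a4).unique h1 a1
        obtain rfl := ((isPrefix_appendZero b0).trans b4).unique h2 b1
        exact ⟨M.appendZero ρ2, fun _ => ⟨a4, b4, len_appendZero b0⟩⟩) (len σ)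
  obtain ⟨h1, h2, h3⟩ := h le_rfl
  rw [← h1.eq_of_len_eq h3, h2.eq_of_len_eq (h3.trans hl)]

theorem isPrefix_iff_bit {σ τ : M.Num} (hσ : σ ≠ 0) (hτ : τ ≠ 0) :
    M.IsPrefix σ τ ↔ len σ ≤ len τ ∧ ∀ i, i < len σ → (Bit σ i ↔ Bit τ i) := by
  constructor
  · exact fun h => ⟨h.len_le, fun i hi => h.bit_iff hi⟩
  · rintro ⟨hl, hb⟩
    obtain ⟨ρ, h1, h2⟩ := exists_prefix hτ hl
    rwa [string_ext hσ h1.1 h2.symm fun i hi => (hb i hi).trans (h1.bit_iff (h2.symm ▸ hi)).symm]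

/-- The string `σ` has length `l` and its bits are given by `p`. -/
def IsString.Describes (σ l : M.Num) (p : M.Num → Prop) : Prop :=
  σ ≠ 0 ∧ len σ = l ∧ ∀ i, i < l → (Bit σ i ↔ p i)

/-- The string is built by appending the prescribed bits one at a time. This produces both the
restrictions of a set and the values of the shift. -/
theorem Pr.exists_describes {p : M.Num → Prop} (hp : M.Pr p) (l : M.Num) :
    ∃ σ, IsString.Describes σ l p := by
  unfold IsString.Describes
  refine sigmaInduction (p := fun l σ => σ ≠ 0 ∧ len σ = l ∧ ∀ i, i < l → (Bit σ i ↔ p i))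
    ((Pr.eq Fn.snd (Fn.const 0)).not.and ((Pr.eq (Fn.len Fn.snd) Fn.fst).and
      (Pr.ball Fn.fst ((Pr.bit Fn.fst.snd' Fn.snd).iff (hp.comp Fn.snd)))))
    ⟨1, one_ne_zero, len_one, fun i hi => absurd hi not_lt_zero⟩ ?_ l
  rintro l σ ⟨h0, rfl, h⟩
  by_cases hp : p (len σ)
  · have h1 := isPrefix_appendOne h0
    refine ⟨M.appendOne σ, h1.ne_zero_right, len_appendOne h0, fun i hi => ?_⟩
    rcases (lt_add_one_iff.1 hi).lt_or_eq with hi | rfl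
    · rw [← h i hi, h1.bit_iff hi]
    · exact iff_of_true ⟨σ, h0, rfl, .refl h1.ne_zero_right⟩ hp
  · have h1 := isPrefix_appendZero h0
    refine ⟨M.appendZero σ, h1.ne_zero_right, len_appendZero h0, fun i hi => ?_⟩
    rcases (lt_add_one_iff.1 hi).lt_or_eq with hi | rfl
    · rw [← h i hi, h1.bit_iff hi]
    · exact iff_of_false (not_bit_of_appendZero h0 (.refl h1.ne_zero_right)) hp

theorem isRestriction_iff {X : Set M.Num} {l σ : M.Num} :
    M.IsRestriction X l σ ↔ IsString.Describes σ l (· ∈ X) := by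
  unfold IsRestriction IsString.Describes
  rw [hasLength_iff_len, and_assoc]
  refine and_congr_right fun h0 => and_congr_right ?_
  rintro rfl
  refine forall_congr' fun i => forall_congr' fun hi => ⟨?_, fun h => ?_⟩
  · rintro ⟨ρ, hρ, h1, h2⟩
    obtain ⟨hρ0, rfl⟩ := hasLength_iff_len.1 hρ
    refine ⟨fun h => ?_, fun h => ⟨ρ, hρ0, rfl, h1 h⟩⟩
    by_contra hX
    exact not_bit_of_appendZero hρ0 (h2 hX) h
  · obtain ⟨ρ, hρ0, hρ, h1, h2⟩ := exists_append_prefix hi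
    exact ⟨ρ, hasLength_iff_len.2 ⟨hρ0, hρ⟩, fun hX => h1 (h.2 hX),
      fun hX => h2 fun hb => hX (h.1 hb)⟩

end Strings

section System

variable {M : L2Structure.{u}} [Fact M.ModelsRCA₀] {α : Type u} [Coded M α]

/-! ### The shift

A point `X` of Cantor space is read as a sequence `Z` with `Z(j) = X(⟨0, j⟩)` together with
sequences `A₀, A₁, …` with `Aᵢ(k) = X(⟨k + 1, i⟩)`. The shift takes `(Z, A₀, A₁, …)` to
`(0Z, A₁, A₂, …)`. -/

theorem Fn.cfst {f : α → M.Num} (hf : M.Fn f) : M.Fn fun a => cfst (f a) := by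
  have : M.Fn (L2Structure.cfst : M.Num → M.Num) :=
    Fn.of_graph (p := fun z x => ∃ y, y ≤ z ∧ z = L2Structure.cpair x y)
      (Pr.bex_le Fn.fst (Pr.eq Fn.fst.fst' (Fn.cpair Fn.fst.snd' Fn.snd))) fun z x => by
        constructor
        · rintro rfl
          refine ⟨csnd z, ?_, (cpair_cfst_csnd z).symm⟩
          conv_rhs => rw [← cpair_cfst_csnd z]
          exact right_le_cpair _ _
        · rintro ⟨y, -, rfl⟩
          exact cfst_cpair x y
  exact this.comp hf

theorem Fn.csnd {f : α → M.Num} (hf : M.Fn f) : M.Fn fun a => csnd (f a) := by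
  have : M.Fn (L2Structure.csnd : M.Num → M.Num) :=
    Fn.of_graph (p := fun z y => z = L2Structure.cpair (L2Structure.cfst z) y)
      (Pr.eq Fn.fst (Fn.cpair (Fn.cfst Fn.fst) Fn.snd)) fun z y => by
        constructor
        · rintro rfl
          exact (cpair_cfst_csnd z).symm
        · intro h
          rw [h, csnd_cpair]
  exact this.comp hf

theorem Pr.describes {f l : α → M.Num} {p : α → M.Num → Prop} (hf : M.Fn f) (hl : M.Fn l)
    (hp : M.Pr fun q : α × M.Num => p q.1 q.2) :
    M.Pr fun a => IsString.Describes (f a) (l a) (p a) :=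
  (Pr.eq hf (Fn.const 0)).not.and ((Pr.eq (Fn.len hf) hl).and
    (Pr.ball hl ((Pr.bit (hf.comp Fn.fst) Fn.snd).iff hp)))

/-- `s z` is the position from which the shift takes the bit in position `z`, the string `F σ` is
the longest one shorter than `σ` that is determined by `σ`, and `L` gives its length. -/
structure IsShift (s L F : M.Num → M.Num) : Prop where
  source_zero : ∀ j, s (cpair 0 (j + 1)) = cpair 0 j
  source_succ : ∀ k i, s (cpair (k + 1) i) = cpair (k + 1) (i + 1)
  source_fn : M.Fn s
  -- With the next field this makes `L m` the least position failing one of two tests: `s j < m`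
  -- keeps the source bit inside the string, and `j + 1 < m` enforces the normalization that values
  -- be shorter than arguments.
  length_max : ∀ m, ¬ (L m + 1 < m ∧ s (L m) < m)
  lt_of_lt_length : ∀ m j, j < L m → j + 1 < m ∧ s j < m
  fn : M.Fn F
  -- Excluding position `cpair 0 0` inserts the new leading zero of `Z`; the bit at its source is
  -- never used.
  describes : ∀ σ, σ ≠ 0 →
    IsString.Describes (F σ) (L (len σ)) fun z => z ≠ cpair 0 0 ∧ Bit σ (s z)

theorem exists_source : ∃ s : M.Num → M.Num, M.Fn s ∧
    (∀ j, s (cpair 0 (j + 1)) = cpair 0 j) ∧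
      ∀ k i, s (cpair (k + 1) i) = cpair (k + 1) (i + 1) := by
  obtain ⟨s, hs, h⟩ := Pr.exists_fn (M := M) (p := fun z w =>
    -- The predecessor is expressed by a bounded quantifier. At `cpair 0 0` the clause is vacuous,
    -- leaving the source there unspecified.
    (cfst z = 0 → ∀ j, j < csnd z → csnd z = j + 1 → w = cpair 0 j) ∧
      (cfst z ≠ 0 → w = cpair (cfst z) (csnd z + 1)))
    ((Pr.imp (Pr.eq (Fn.cfst Fn.fst) (Fn.const 0)) (Pr.ball (Fn.csnd Fn.fst)
      (Pr.imp (Pr.eq (Fn.csnd Fn.fst.fst') (Fn.snd.add (Fn.const 1)))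
        (Pr.eq Fn.fst.snd' (Fn.cpair (Fn.const 0) Fn.snd))))).and
      (Pr.imp (Pr.eq (Fn.cfst Fn.fst) (Fn.const 0)).not (Pr.eq Fn.snd
        (Fn.cpair (Fn.cfst Fn.fst) ((Fn.csnd Fn.fst).add (Fn.const 1))))))
    (fun z => by
      by_cases h0 : cfst z = 0
      · rcases modelsRCA₀.eq_zero_or_succ (csnd z) with h | ⟨j, hj⟩
        · exact ⟨0, fun _ j hj => absurd (h ▸ hj) not_lt_zero, fun h => absurd h0 h⟩
        · refine ⟨cpair 0 j, fun _ j' _ h => ?_, fun h => absurd h0 h⟩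
          rw [add_right_cancel (hj.symm.trans h)]
      · exact ⟨_, fun h => absurd h h0, fun _ => rfl⟩)
  refine ⟨s, hs, fun j => ?_, fun k i => ?_⟩
  · have := (h (cpair 0 (j + 1))).1
    rw [cfst_cpair, csnd_cpair] at this
    exact this rfl j (lt_add_one_iff.2 le_rfl) rfl
  · have := (h (cpair (k + 1) i)).2
    rw [cfst_cpair, csnd_cpair] at this
    exact this (modelsRCA₀.basic.succ_ne_zero k)

theorem exists_isShift : ∃ s L F : M.Num → M.Num, IsShift s L F := by
  obtain ⟨s, hs, h0, h1⟩ := exists_source (M := M)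
  obtain ⟨L, hL, hL'⟩ := Pr.exists_fn (M := M) (α := M.Num) (p := fun m l =>
    ¬ (l + 1 < m ∧ s l < m) ∧ ∀ j, j < l → j + 1 < m ∧ s j < m)
    (((Pr.lt (Fn.snd.add (Fn.const 1)) Fn.fst).and (Pr.lt (hs.comp Fn.snd) Fn.fst)).not.and
      (Pr.ball Fn.snd ((Pr.lt (Fn.snd.add (Fn.const 1)) Fn.fst.fst').and
        (Pr.lt (hs.comp Fn.snd) Fn.fst.fst'))))
    (fun m => by
      obtain ⟨l, hl, hl'⟩ := Pr.exists_least (p := fun l => ¬ (l + 1 < m ∧ s l < m))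
        ((Pr.lt (Fn.id.add (Fn.const 1)) (Fn.const m)).and (Pr.lt hs (Fn.const m))).not
        ⟨m, fun h => absurd h.1 (not_lt.2 le_self_add)⟩
      exact ⟨l, hl, fun j hj => not_not.1 (hl' j hj)⟩)
  have hp {β : Type u} [Coded M β] {f g : β → M.Num} (hf : M.Fn f) (hg : M.Fn g) :
      M.Pr fun b => f b ≠ cpair 0 0 ∧ Bit (g b) (s (f b)) :=
    (Pr.eq hf (Fn.const _)).not.and (Pr.bit hg (hs.comp hf))
  obtain ⟨F, hF, hF'⟩ := Pr.exists_fn (M := M) (α := M.Num) (p := fun σ τ =>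
    IsString.Describes τ (L (len σ)) fun z => z ≠ cpair 0 0 ∧ Bit σ (s z))
    (Pr.describes (p := fun (q : M.Num × M.Num) z => z ≠ cpair 0 0 ∧ Bit q.1 (s z))
      Fn.snd (hL.comp (Fn.len Fn.fst)) (hp Fn.snd Fn.fst.fst'))
    (fun σ => (hp Fn.id (Fn.const σ)).exists_describes _)
  exact ⟨s, L, F, h0, h1, hs, fun m => (hL' m).1, fun m => (hL' m).2, hF, fun σ _ => hF' σ⟩

namespace IsShift

variable {s L F : M.Num → M.Num} (h : IsShift s L F)
include h

theorem length_lt {m : M.Num} (hm : m ≠ 0) : L m < m := by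
  rcases modelsRCA₀.eq_zero_or_succ (L m) with h0 | ⟨l, hl⟩
  · rw [h0]
    exact pos_iff_ne_zero.2 hm
  · have := h.lt_of_lt_length m l (hl ▸ lt_add_one_iff.2 le_rfl)
    rw [hl]
    exact this.1

theorem length_mono {m m' : M.Num} (hm : m ≤ m') : L m ≤ L m' := by
  by_contra! hlt
  have := h.lt_of_lt_length m _ hlt
  exact h.length_max m' ⟨this.1.trans_le hm, this.2.trans_le hm⟩

/-- The sources of the first `l` positions are bounded, by `Fn.exists_bound`, so a long enough input
determines all of them. This is continuity. -/
theorem exists_le_length (l : M.Num) : ∃ m, l ≤ L m := by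
  obtain ⟨b, hb⟩ := h.source_fn.exists_bound l
  refine ⟨b + l + 1, ?_⟩
  by_contra! hlt
  refine h.length_max (b + l + 1) ⟨?_, ?_⟩
  · exact lt_add_one_iff.2 ((Order.add_one_le_iff.2 hlt).trans le_add_self)
  · exact lt_add_one_iff.2 ((hb _ hlt).trans le_self_add)

theorem ne_zero {σ : M.Num} (hσ : σ ≠ 0) : F σ ≠ 0 := (h.describes σ hσ).1

theorem len_eq {σ : M.Num} (hσ : σ ≠ 0) : len (F σ) = L (len σ) := (h.describes σ hσ).2.1

theorem bit_iff {σ z : M.Num} (hσ : σ ≠ 0) (hz : z < len (F σ)) :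
    Bit (F σ) z ↔ z ≠ cpair 0 0 ∧ Bit σ (s z) :=
  (h.describes σ hσ).2.2 z (h.len_eq hσ ▸ hz)

theorem source_lt {σ z : M.Num} (hσ : σ ≠ 0) (hz : z < len (F σ)) : s z < len σ :=
  (h.lt_of_lt_length _ _ (h.len_eq hσ ▸ hz)).2

theorem isPrefix {σ τ : M.Num} (hστ : M.IsPrefix σ τ) : M.IsPrefix (F σ) (F τ) := by
  have hσ := hστ.1
  have hτ := hστ.ne_zero_right
  have hl : len (F σ) ≤ len (F τ) := by
    rw [h.len_eq hσ, h.len_eq hτ]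
    exact h.length_mono hστ.len_le
  refine (isPrefix_iff_bit (h.ne_zero hσ) (h.ne_zero hτ)).2 ⟨hl, fun i hi => ?_⟩
  rw [h.bit_iff hσ hi, h.bit_iff hτ (hi.trans_le hl), hστ.bit_iff (h.source_lt hσ hi)]

theorem graph_mem_sets : pairSet (fun σ τ => σ ≠ 0 ∧ F σ = τ) ∈ M.sets :=
  pairSet_mem_sets ((Pr.eq Fn.fst (Fn.const 0)).not.and (Pr.eq (h.fn.comp Fn.fst) Fn.snd))

theorem encodesTransformation :
    M.EncodesTransformation (pairSet fun σ τ => σ ≠ 0 ∧ F σ = τ) where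
  graph := by
    rintro z ⟨σ, τ, rfl, hσ, rfl⟩
    exact ⟨σ, _, hσ, h.ne_zero hσ, rfl⟩
  total σ hσ := ⟨F σ, pair_mem_pairSet.2 ⟨hσ, rfl⟩, fun τ hτ => (pair_mem_pairSet.1 hτ).2.symm⟩
  monotone σ σ' τ τ' hσ hσ' hp := by
    obtain ⟨-, rfl⟩ := pair_mem_pairSet.1 hσ
    obtain ⟨-, rfl⟩ := pair_mem_pairSet.1 hσ'
    exact h.isPrefix hp
  unbounded l := by
    obtain ⟨m, hm⟩ := h.exists_le_length l
    refine ⟨m, fun σ hσ => ?_⟩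
    obtain ⟨h0, rfl⟩ := hasLength_iff_len.1 hσ
    exact ⟨F σ, _, pair_mem_pairSet.2 ⟨h0, rfl⟩,
      hasLength_iff_len.2 ⟨h.ne_zero h0, h.len_eq h0⟩, hm⟩
  shorter σ τ hστ hne := by
    obtain ⟨hσ, rfl⟩ := pair_mem_pairSet.1 hστ
    refine ⟨_, _, hasLength_len (h.ne_zero hσ), hasLength_len hσ, ?_⟩
    rw [h.len_eq hσ]
    refine h.length_lt fun h0 => hne ?_
    exact string_ext hσ one_ne_zero (h0.trans len_one.symm) fun i hi =>
      absurd (h0 ▸ hi) not_lt_zero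

/-- The `m`-th iterate of the shift produces strings that begin with `m` zeros in the first
component. -/
theorem not_bit_of_iterString {m σ τ j : M.Num}
    (hm : M.IterString (pairSet fun σ τ => σ ≠ 0 ∧ F σ = τ) m σ τ) (hj : j < m) :
    ¬ Bit τ (cpair 0 j) := by
  obtain ⟨g, hg, hfun, -, hs, hτ⟩ := hm
  choose G hG hG' using fun x => (hfun.2 x).exists
    |>.imp fun y hy => (⟨hy, fun z hz => (hfun.2 x).unique hz hy⟩ : _ ∧ ∀ z, M.pair x z ∈ g → z = y)
  have hGfn : M.Fn G := Fn.of_graph (p := fun x y => M.pair x y ∈ g)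
    (Pr.mem hg (Fn.pair Fn.fst Fn.snd)) fun x y =>
      ⟨fun h => h ▸ hG x, fun h => (hG' x y h).symm⟩
  -- Asserting the absence of ones, rather than the presence of zeros, is trivially true beyond the
  -- end of a string, so lengths need no tracking.
  have key : ∀ i, ∀ j, j < i → ¬ Bit (G i) (cpair 0 j) := by
    refine Pr.induction (Pr.ball Fn.id (Pr.bit (hGfn.comp Fn.fst)
      (Fn.cpair (Fn.const 0) Fn.snd)).not) (fun j hj => absurd hj not_lt_zero) ?_
    intro i ih j hj hb
    obtain ⟨h0, hF⟩ := pair_mem_pairSet.1 (hs i _ _ (hG i) (hG (i + 1)))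
    rw [← hF, h.bit_iff h0 (hF ▸ hb.lt_len)] at hb
    rcases modelsRCA₀.eq_zero_or_succ j with rfl | ⟨j, rfl⟩
    · exact hb.1 rfl
    · rw [h.source_zero] at hb
      exact ih j (add_lt_add_iff_right 1 |>.1 hj) hb.2
  rw [hG' m τ hτ]
  exact key m j hj

end IsShift

/-! ### The system attached to a tree -/

/-- The string `σ` is compatible with being an initial segment of a point `(Z, A₀, A₁, …)` such that
`Aᵢ ↾ (n + i)` lies in `T` whenever `Z` begins with `n` zeros. -/
def InSystem (T : Set M.Num) (σ : M.Num) : Prop :=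
  -- Only positions visible in `σ` are tested, and the bounds by `len σ` keep the condition
  -- decidable. The inequality `l ≤ n + i`, rather than equality, is what lets the case `n = 0`
  -- survive the shift.
  σ ≠ 0 ∧ ∀ n, n ≤ len σ → ∀ i, i ≤ len σ → ∀ l, l ≤ len σ → l ≤ n + i →
    (∀ j, j < n → cpair 0 j < len σ ∧ ¬ Bit σ (cpair 0 j)) →
    (∀ k, k < l → cpair (k + 1) i < len σ) →
    ∃ ρ, ρ ∈ T ∧ IsString.Describes ρ l fun k => Bit σ (cpair (k + 1) i)

/-- This bounds the search for the string of `T` required by `InSystem`. -/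
theorem IsString.Describes.lt {σ l : M.Num} {p : M.Num → Prop} (h : IsString.Describes σ l p) :
    σ < (1 + 1) * exp2 l := by
  obtain ⟨h0, rfl, -⟩ := h
  exact lt_two_mul_exp2_len h0

theorem IsString.Describes.congr {σ l : M.Num} {p q : M.Num → Prop}
    (h : IsString.Describes σ l p) (hpq : ∀ i, i < l → (p i ↔ q i)) :
    IsString.Describes σ l q :=
  ⟨h.1, h.2.1, fun i hi => (h.2.2 i hi).trans (hpq i hi)⟩

theorem IsString.Describes.bit_iff {σ l i : M.Num} {p : M.Num → Prop}
    (h : IsString.Describes σ l p) (hi : i < l) : Bit σ i ↔ p i :=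
  h.2.2 i hi

theorem inSystem_mem_sets {T : Set M.Num} (hT : T ∈ M.sets) : {σ | InSystem T σ} ∈ M.sets := by
  have hρ : M.Pr fun q : M.Num × M.Num × M.Num => ∃ ρ, ρ < (1 + 1) * exp2 q.2.2 ∧
      (ρ ∈ T ∧ IsString.Describes ρ q.2.2 fun k => Bit q.1 (cpair (k + 1) q.2.1)) :=
    Pr.bex ((Fn.const _).mul (Fn.exp2 Fn.snd.snd')) ((Pr.mem hT Fn.snd).and
      (Pr.describes (p := fun (q : (M.Num × M.Num × M.Num) × M.Num) k =>
        Bit q.1.1 (cpair (k + 1) q.1.2.1)) Fn.snd Fn.fst.snd'.snd'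
        (Pr.bit Fn.fst.fst'.fst' (Fn.cpair (Fn.snd.add (Fn.const 1)) Fn.fst.fst'.snd'.fst'))))
  have hρ' : M.Pr fun q : M.Num × M.Num × M.Num => ∃ ρ, ρ ∈ T ∧
      IsString.Describes ρ q.2.2 fun k => Bit q.1 (cpair (k + 1) q.2.1) :=
    hρ.of_iff fun q => exists_congr fun ρ => ⟨fun h => ⟨h.2.lt, h⟩, And.right⟩
  have hρ'' := hρ'.comp
    (f := fun q : ((M.Num × M.Num) × M.Num) × M.Num => (q.1.1.1, q.1.2, q.2))
    (Fn.fst.fst'.fst'.prodMk (Fn.fst.snd'.prodMk Fn.snd))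
  change M.Pr fun σ => InSystem T σ
  unfold InSystem
  repeat' first
    | with_reducible exact Fn.id
    | with_reducible exact Fn.const _
    | with_reducible exact hρ''
    | with_reducible apply Pr.and
    | with_reducible apply Pr.ball_le
    | with_reducible apply Pr.ball
    | with_reducible apply Pr.eq
    | with_reducible apply Pr.lt
    | with_reducible apply Pr.le
    | with_reducible apply Pr.bit
    | with_reducible apply Pr.not
    | with_reducible apply Pr.imp
    | with_reducible apply Fn.cpair
    | with_reducible apply Fn.len
    | with_reducible apply Fn.fst'
    | with_reducible apply Fn.snd'
    | with_reducible apply Fn.add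

/-- Every test visible in a prefix is visible in the longer string, with the same bits. -/
theorem isTree_inSystem (T : Set M.Num) : M.IsTree {σ | InSystem T σ} := by
  refine ⟨fun σ hσ => hσ.1, fun σ τ hτ hp => ⟨hp.1, ?_⟩⟩
  intro n hn i hi l hl hln hz ha
  have hle := hp.len_le
  obtain ⟨ρ, hρT, hρ⟩ := hτ.2 n (hn.trans hle) i (hi.trans hle) l (hl.trans hle) hln
    (fun j hj => ⟨(hz j hj).1.trans_le hle, (hp.bit_iff (hz j hj).1).not.1 (hz j hj).2⟩)
    (fun k hk => (ha k hk).trans_le hle)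
  exact ⟨ρ, hρT, hρ.congr fun k hk => (hp.bit_iff (ha k hk)).symm⟩

/-- If `0Z` begins with `n + 1` zeros then `Z` begins with `n`, and the new `Aᵢ` is the old one of
index `i + 1`. The bound `(n + 1) + i = n + (i + 1)` is unchanged. -/
theorem IsShift.inSystem {s L F : M.Num → M.Num} (h : IsShift s L F) {T : Set M.Num} {σ : M.Num}
    (hσ : InSystem T σ) : InSystem T (F σ) := by
  have h0 := hσ.1
  refine ⟨h.ne_zero h0, fun n hn i hi l hl hln hz ha => ?_⟩
  -- On the empty string the shift does not shorten, so `i + 1 ≤ len σ` would fail. There only `l =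
  -- 0` is possible, and the test of `σ` at `n = i = l = 0` puts the empty string in `T`.
  rcases eq_or_ne (len σ) 0 with hlen | hlen
  · have hl0 : l = 0 := by
      rcases eq_or_ne l 0 with hl0 | hl0
      · exact hl0
      · have := h.source_lt h0 ((pos_iff_ne_zero.2 hl0).trans_le hl)
        rw [hlen] at this
        exact absurd this not_lt_zero
    subst hl0
    obtain ⟨ρ, hρT, hρ⟩ := hσ.2 0 zero_le 0 zero_le 0 zero_le zero_le
      (fun j hj => absurd hj not_lt_zero) (fun k hk => absurd hk not_lt_zero)
    exact ⟨ρ, hρT, hρ.congr fun k hk => absurd hk not_lt_zero⟩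
  · have hlt : len (F σ) < len σ := by
      rw [h.len_eq h0]
      exact h.length_lt hlen
    have ha' (k : M.Num) (hk : k < l) : cpair (k + 1) (i + 1) < len σ := by
      rw [← h.source_succ]
      exact h.source_lt h0 (ha k hk)
    have hi' : i + 1 ≤ len σ := Order.add_one_le_iff.2 (hi.trans_lt hlt)
    -- Here `n'` is the truncated predecessor of `n`. For `n = 0` it gives only `l ≤ i ≤ i + 1`,
    -- which suffices.
    obtain ⟨n', hn', hle, hz'⟩ : ∃ n', n' ≤ n ∧ n ≤ n' + 1 ∧ ∀ j, j < n' → j + 1 < n := by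
      rcases modelsRCA₀.eq_zero_or_succ n with rfl | ⟨n', rfl⟩
      · exact ⟨0, le_rfl, zero_le, fun j hj => absurd hj not_lt_zero⟩
      · exact ⟨n', le_self_add, le_rfl, fun j hj => add_lt_add_iff_right 1 |>.2 hj⟩
    obtain ⟨ρ, hρT, hρ⟩ := hσ.2 n' (hn'.trans (hn.trans hlt.le)) (i + 1) hi' l (hl.trans hlt.le)
      (hln.trans ((add_le_add_left hle i).trans_eq (by ring)))
      (fun j hj => by
        obtain ⟨h1, h2⟩ := hz _ (hz' j hj)
        have h3 := h.source_lt h0 h1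
        rw [h.bit_iff h0 h1, h.source_zero] at h2
        rw [h.source_zero] at h3
        exact ⟨h3, fun hb => h2 ⟨fun e =>
          modelsRCA₀.basic.succ_ne_zero j (cpair_inj e).2, hb⟩⟩) ha'
    refine ⟨ρ, hρT, hρ.congr fun k hk => ?_⟩
    rw [h.bit_iff h0 (ha k hk), h.source_succ]
    exact (and_iff_right fun e => modelsRCA₀.basic.succ_ne_zero k (cpair_inj e).1).symm

/-! ### A point of the system. -/

/-- A code above `2 ^ (l + 1)` has length at least `l`, so an unbounded set of codes contains long
strings, which can be truncated inside the tree. -/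
theorem exists_mem_len {T : Set M.Num} (hT : M.IsTree T) (hinf : M.IsInfinite T) (l : M.Num) :
    ∃ σ, σ ∈ T ∧ len σ = l := by
  obtain ⟨τ, hτ, hlt⟩ := hinf ((1 + 1) * exp2 l)
  have h0 : τ ≠ 0 := hT.1 τ hτ
  have hl : l ≤ len τ := by
    by_contra! h
    have h1 := lt_two_mul_exp2_len h0
    have h2 : (1 + 1) * exp2 (len τ) ≤ (1 + 1) * exp2 l := mul_le_mul' le_rfl (exp2_mono h.le)
    exact absurd (h1.trans_le h2) (not_lt.2 hlt.le)
  obtain ⟨ρ, h1, h2⟩ := exists_prefix h0 hl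
  exact ⟨ρ, hT.2 _ _ hτ h1, h2⟩

/-- The point has `Z = 1000…` and `Aᵢ` equal to `t i` followed by zeros, where `t i` is a string of
`T` of length `i`. The different `t i` need not be compatible. -/
theorem exists_isPath_inSystem {T : Set M.Num} (hT : T ∈ M.sets) (htree : M.IsTree T)
    (hinf : M.IsInfinite T) : ∃ X ∈ M.sets, M.IsPath {σ | InSystem T σ} X := by
  obtain ⟨t, ht, ht'⟩ := Pr.exists_fn (M := M) (α := M.Num) (p := fun i σ => σ ∈ T ∧ len σ = i)
    ((Pr.mem hT Fn.snd).and (Pr.eq (Fn.len Fn.snd) Fn.fst)) (exists_mem_len htree hinf)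
  let p : M.Num → Prop := fun z => z = cpair 0 0 ∨
    ∃ k, k < cfst z ∧ (cfst z = k + 1 ∧ Bit (t (csnd z)) k)
  have hp : M.Pr p := (Pr.eq Fn.id (Fn.const _)).or (Pr.bex (Fn.cfst Fn.id)
    ((Pr.eq (Fn.cfst Fn.fst) (Fn.snd.add (Fn.const 1))).and
      (Pr.bit (ht.comp (Fn.csnd Fn.fst)) Fn.snd)))
  have hpA (k i : M.Num) : p (cpair (k + 1) i) ↔ Bit (t i) k := by
    simp only [p, cfst_cpair, csnd_cpair]
    constructor
    · rintro (h | ⟨k', -, h, h'⟩)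
      · exact absurd (cpair_inj h).1 (modelsRCA₀.basic.succ_ne_zero k)
      · rwa [add_right_cancel h]
    · exact fun h => Or.inr ⟨k, lt_add_one_iff.2 le_rfl, rfl, h⟩
  refine ⟨{z | p z}, hp, fun m => ?_⟩
  obtain ⟨σ, hσ⟩ := hp.exists_describes m
  refine ⟨σ, ⟨hσ.1, fun n hn i hi l hl hln hz ha => ?_⟩, isRestriction_iff.2 hσ⟩
  rw [hσ.2.1] at ha hz
  -- A positive `n` would require a visible zero at the first position of `Z`, which holds a one.
  obtain rfl : n = 0 := by
    by_contra hn0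
    obtain ⟨h1, h2⟩ := hz 0 (pos_iff_ne_zero.2 hn0)
    exact h2 ((hσ.bit_iff h1).2 (Or.inl rfl))
  rw [zero_add] at hln
  obtain ⟨hiT, hil⟩ := ht' i
  obtain ⟨ρ, h1, rfl⟩ := exists_prefix (htree.1 _ hiT) (hln.trans_eq hil.symm)
  refine ⟨ρ, htree.2 _ _ hiT h1, h1.1, rfl, fun k hk => ?_⟩
  exact (h1.bit_iff hk).trans ((hpA k i).symm.trans (hσ.bit_iff (ha k hk)).symm)

/-! ### From a recurrent point to a path. -/

theorem exists_isPath_of_isRecurrentPoint {s L F : M.Num → M.Num} (h : IsShift s L F)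
    {T X : Set M.Num} (hX : X ∈ M.sets) (hrec : M.IsRecurrentPoint {σ | InSystem T σ}
      (pairSet fun σ τ => σ ≠ 0 ∧ F σ = τ) X) : ∃ A ∈ M.sets, M.IsPath T A := by
  obtain ⟨hpath, hrec⟩ := hrec
  have hZ (j : M.Num) : cpair 0 j ∉ X := by
    intro hj
    -- The iterate is taken beyond `j`, so its `Z` vanishes at `j`, and the agreement is long enough
    -- to include position `cpair 0 j`.
    obtain ⟨k, Y, -, hY, ρ, hρX, hρY⟩ := hrec (j + 1) (cpair 0 j + 1)
    obtain ⟨l, σ, τ, ρ', -, hiter, hρ', hpre⟩ := hY (cpair 0 j + 1)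
    rw [isRestriction_iff] at hρX hρY hρ'
    have hlt : cpair 0 j < cpair 0 j + 1 := lt_add_one_iff.2 le_rfl
    refine h.not_bit_of_iterString hiter
      ((lt_add_one_iff.2 le_rfl).trans_le (le_self_add (b := k)) : j < j + 1 + k) ?_
    rw [← hpre.bit_iff (hρ'.2.1.symm ▸ hlt), hρ'.bit_iff hlt, ← hρY.bit_iff hlt, hρX.bit_iff hlt]
    exact hj
  refine ⟨{k | cpair (k + 1) 0 ∈ X},
    Pr.mem hX (Fn.cpair (Fn.id.add (Fn.const 1)) (Fn.const 0)), fun l => ?_⟩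
  -- This length makes `Z ↾ l` and `A₀ ↾ l` both visible and is at least `l`, as the test with `n =
  -- l` and `i = 0` requires.
  obtain ⟨σ, hσ, hσX⟩ := hpath (cpair 0 l + cpair (l + 1) 0 + 1)
  rw [isRestriction_iff] at hσX
  have hl : l ≤ len σ := by
    rw [hσX.2.1, add_assoc]
    exact (right_le_cpair 0 l).trans le_self_add
  have hZlt (j : M.Num) (hj : j < l) : cpair 0 j < cpair 0 l + cpair (l + 1) 0 + 1 :=
    lt_add_one_iff.2 ((cpair_mono le_rfl hj.le).trans le_self_add)
  have hAlt (k : M.Num) (hk : k < l) : cpair (k + 1) 0 < cpair 0 l + cpair (l + 1) 0 + 1 :=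
    lt_add_one_iff.2 ((cpair_mono (add_le_add_left hk.le 1) le_rfl).trans le_add_self)
  obtain ⟨ρ, hρT, hρ⟩ := hσ.2 l hl 0 zero_le l hl le_self_add
    (fun j hj => ⟨hσX.2.1.symm ▸ hZlt j hj, fun hb => hZ j ((hσX.bit_iff (hZlt j hj)).1 hb)⟩)
    (fun k hk => hσX.2.1.symm ▸ hAlt k hk)
  exact ⟨ρ, hρT, isRestriction_iff.2 (hρ.congr fun k hk => hσX.bit_iff (hAlt k hk))⟩

end System

end L2Structure

end SecondOrderArith

theorem mainTheorem1 (M : SecondOrderArith.L2Structure.{u}) (hM : M.ModelsRCA₀) (hRP : M.RP) :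
    M.WKL := by
  have : Fact M.ModelsRCA₀ := ⟨hM⟩
  intro T hT htree hinf
  obtain ⟨s, L, F, h⟩ := SecondOrderArith.L2Structure.exists_isShift (M := M)
  obtain ⟨X, hX, hrec⟩ := hRP _ (SecondOrderArith.L2Structure.inSystem_mem_sets hT) _
    h.graph_mem_sets
    { tree := SecondOrderArith.L2Structure.isTree_inSystem T
      transformation := h.encodesTransformation
      nonempty := SecondOrderArith.L2Structure.exists_isPath_inSystem hT htree hinf
      invariant := fun σ τ hσ hστ => by
        obtain ⟨-, rfl⟩ := SecondOrderArith.L2Structure.pair_mem_pairSet.1 hστ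
        exact h.inSystem hσ }
  exact SecondOrderArith.L2Structure.exists_isPath_of_isRecurrentPoint h hX hrec
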